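/- Let $c$ be a smooth real function on an open set $I\subseteq\mathbb R$ and consider the nonlinear wave equation $u_{tt}=(c^2(u)u_x)_x$ with $u\in I$, its potential system $v_x=u_t,\ v_t=c^2(u)u_x$, the point transformation $\rho:(x,t,u,v)\mapsto(X,T,U,V)=(x,u,t+v,v)$, and the scalar equation for $U(X,T)$, $T\in I$, obtained from the potential system by applying $\rho$ and excluding $V$: $$U_{TT}+c^2(T)\bigl(c^2(T)U_{XX}-U_{XX}U_T^2-U_{TT}U_X^2-2U_{TX}+2U_{TX}U_TU_X\bigr)-2c(T)c'(T)\bigl(U_X-U_X^2U_T\bigr)=0.\qquad(*)$$ A vector field $\mathbf W=\xi\,\partial_X+\tau\,\partial_T+\varphi\,\partial_U$ on $(X,T,U)$-space is *traced back* to a generator $\mathbf Z=Z^x\partial_x+Z^t\partial_t+Z^u\partial_u+Z^v\partial_v$ if $\rho_*\mathbf Z=\mathbf W+g\,\partial_V$ for some coefficient $g$, that is, $Z^x=\xi$, $Z^u=\tau$, $Z^t+Z^v=\varphi$, with $\xi,\tau,\varphi$ evaluated at $(x,u,t+v)$. Put $\delta u=Z^u-Z^xu_x-Z^tu_t$ and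 $\delta v=Z^v-Z^xv_x-Z^tv_t$. A *differential function* is a smooth function of $x$, $t$ and finitely many derivatives (including order $0$) of the dependent variables. We say that $\mathbf W$ *yields a nonlocal symmetry of the wave equation* if the following hold. 1. $\mathbf W$ is a point symmetry of $(*)$ (infinitesimal criterion on the solution manifold in jet space). 2. $\mathbf W$ yields a symmetry of the wave equation: every smooth solution $u$ on a convex open set $\Omega\subseteq\mathbb R^2$ has a smooth potential $v$ on $\Omega$, and for every such $v$ there is a $\mathbf Z$ with smooth coefficients on $\Omega$, tracing back $\mathbf W$ along $(u,v)$, such that $(\delta u,\delta v)$ solves the linearization of the potential system at $(u,v)$ and $\delta u$ solves the linearization of the wave equation at $u$. 3. This symmetry is not local: there is no open set $O$ of jets of $(u,v)$ with $u\in I$, meeting the solution manifold of the potential system, over which $\mathbf W$ can be traced back to a generator $\mathbf Z$ whose coefficients are differential functions of $(u,v)$, which is a symmetry of the potential system, and whose $\delta u$ coincides on the solution manifold with a differential function of $u$ alone (one not involving $v$). **Theorem.** (a) For arbitrary smooth $c$ on an open set $I$, and any $C$ with $C'=c^2$ on $I$, the vector field $\mathbf W_3=(X+C(T))\,\partial_X+U\,\partial_U$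 yields a nonlocal symmetry of $u_{tt}=(c^2(u)u_x)_x$. (b) For $c(u)=u^{-2}$, $u\neq0$, the vector field $\mathbf W_6=U^2\,\partial_U+TU\,\partial_T-\frac{U}{T^3}\,\partial_X$ yields a nonlocal symmetry of $u_{tt}=(c^2(u)u_x)_x$. (c) For $c(u)=u^{-2/3}$, $u>0$, the vector field $\mathbf W_7=(XT-3T^{2/3})\,\partial_T+\bigl(XT^{-1/3}-\tfrac{X^2}{3}\bigr)\,\partial_X$ yields a nonlocal symmetry of $u_{tt}=(c^2(u)u_x)_x$. -/

import Mathlib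

open scoped ContDiff

namespace NonlinearWave

noncomputable section

/-! ### Infinite jets in two independent variables, differential functions, local symmetries -/

/-- Points of the infinite jet space with two independent variables and dependent variables
indexed by `ι`. For `z : Jet ι`, `z.1` and `z.2.1` are the first and the second independent
variable, and `z.2.2 a i j` is the coordinate of the derivative of the `a`-th dependent variable
taken `i` times in the first and `j` times in the second independent variable. -/
abbrev Jet (ι : Type) : Type := ℝ × ℝ × (ι → ℕ → ℕ → ℝ)

/-- The finitely many jet coordinates with at most `n` derivatives in each independent variable. -/
def trunc {ι : Type} (n : ℕ) (z : Jet ι) : ℝ × ℝ × (ι → Fin (n + 1) → Fin (n + 1) → ℝ) :=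
  (z.1, z.2.1, fun a i j => z.2.2 a i j)

/-- `F` is a differential function on `O`: on `O` it is a smooth function of finitely many
jet coordinates. -/
def IsDifferentialFunctionOn {ι : Type} [Fintype ι] (F : Jet ι → ℝ) (O : Set (Jet ι)) : Prop :=
  ∃ (n : ℕ) (V : Set (ℝ × ℝ × (ι → Fin (n + 1) → Fin (n + 1) → ℝ)))
    (f : ℝ × ℝ × (ι → Fin (n + 1) → Fin (n + 1) → ℝ) → ℝ),
    IsOpen V ∧ ContDiffOn ℝ ∞ f V ∧ ∀ z ∈ O, trunc n z ∈ V ∧ F z = f (trunc n z)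

/-- Total derivative in the first independent variable: the derivative along the vector
`∂/∂x + ∑ u^a_{i+1,j} ∂/∂u^a_{i,j}`. -/
def DX {ι : Type} (F : Jet ι → ℝ) (z : Jet ι) : ℝ :=
  lineDeriv ℝ F z (1, 0, fun a i j => z.2.2 a (i + 1) j)

/-- Total derivative in the second independent variable: the derivative along the vector
`∂/∂t + ∑ u^a_{i,j+1} ∂/∂u^a_{i,j}`. -/
def DT {ι : Type} (F : Jet ι → ℝ) (z : Jet ι) : ℝ :=
  lineDeriv ℝ F z (0, 1, fun a i j => z.2.2 a i (j + 1))

/-- The solution manifold in the infinite jet space of the system `R^k = 0`: all the equations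
and all their differential consequences hold. -/
def shell {ι κ : Type} (R : κ → Jet ι → ℝ) : Set (Jet ι) :=
  {z | ∀ k i j, (DX^[i] (DT^[j] (R k))) z = 0}

/-- The value at `z` of the infinite prolongation `∑ (D_x^i D_t^j Q^a) ∂/∂u^a_{i,j}` of the
evolutionary vector field `∑ Q^a ∂/∂u^a`. -/
def prolong {ι : Type} (Q : ι → Jet ι → ℝ) (z : Jet ι) : Jet ι :=
  (0, 0, fun a i j => (DX^[i] (DT^[j] (Q a))) z)

/-- The infinitesimal criterion, over the jets in `O`: the prolonged evolutionary vector field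
with characteristic `Q` annihilates all the equations on the solution manifold. -/
def IsSymmetryOn {ι κ : Type} (R : κ → Jet ι → ℝ) (Q : ι → Jet ι → ℝ) (O : Set (Jet ι)) : Prop :=
  ∀ z ∈ O, z ∈ shell R → ∀ k, lineDeriv ℝ (R k) z (prolong Q z) = 0

/-! ### The subsystem for `U(X,T)`, and vector fields on the `(X,T,U)`-space -/

/-- A vector field `ξ ∂/∂X + τ ∂/∂T + φ ∂/∂U`, the coefficients being functions of `X`, `T`, `U`
in this order. -/
structure Generator where
  ξ : ℝ → ℝ → ℝ → ℝ
  τ : ℝ → ℝ → ℝ → ℝ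
  φ : ℝ → ℝ → ℝ → ℝ

/-- The left-hand side of the equation
`U_TT + c²(T) (c²(T) U_XX - U_XX U_T² - U_TT U_X² - 2 U_TX + 2 U_TX U_T U_X)
  - 2 c(T) c'(T) (U_X - U_X² U_T) = 0`
for `U(X,T)`. -/
def subsystem (c : ℝ → ℝ) : Fin 1 → Jet (Fin 1) → ℝ := fun _ z =>
  let T := z.2.1
  let U := z.2.2 0
  U 0 2 + c T ^ 2 * (c T ^ 2 * U 2 0 - U 2 0 * U 0 1 ^ 2 - U 0 2 * U 1 0 ^ 2 - 2 * U 1 1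
      + 2 * U 1 1 * U 0 1 * U 1 0)
    - 2 * c T * deriv c T * (U 1 0 - U 1 0 ^ 2 * U 0 1)

/-- The characteristic `φ - ξ U_X - τ U_T` of a vector field. -/
def Generator.characteristic (W : Generator) : Fin 1 → Jet (Fin 1) → ℝ := fun _ z =>
  let U := z.2.2 0
  W.φ z.1 z.2.1 (U 0 0) - W.ξ z.1 z.2.1 (U 0 0) * U 1 0 - W.τ z.1 z.2.1 (U 0 0) * U 0 1

/-- `W` is a point symmetry of the subsystem for `U(X,T)`, where `T` ranges over `I`. -/
def IsPointSymmetry (c : ℝ → ℝ) (I : Set ℝ) (W : Generator) : Prop :=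
  IsSymmetryOn (subsystem c) W.characteristic {z | z.2.1 ∈ I}

/-- `(X + C(T)) ∂/∂X + U ∂/∂U`, where `C` stands for an antiderivative of `c²`. -/
def W₃ (C : ℝ → ℝ) : Generator where
  ξ := fun X T _ => X + C T
  τ := fun _ _ _ => 0
  φ := fun _ _ U => U

/-- `U² ∂/∂U + T U ∂/∂T - (U / T³) ∂/∂X`. -/
def W₆ : Generator where
  ξ := fun _ T U => -(U / T ^ 3)
  τ := fun _ T U => T * U
  φ := fun _ _ U => U ^ 2

/-- `(X T - 3 T^(2/3)) ∂/∂T + (X T^(-1/3) - X²/3) ∂/∂X`. -/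
def W₇ : Generator where
  ξ := fun X T _ => X * T ^ (-(1 / 3) : ℝ) - X ^ 2 / 3
  τ := fun X T _ => X * T - 3 * T ^ (2 / 3 : ℝ)
  φ := fun _ _ _ => 0

/-! ### Tracing back through the point transformation -/

/-- The point transformation `(x,t,u,v) ↦ (X,T,U,V) = (x, u, t + v, v)`. -/
def rho (p : ℝ × ℝ × ℝ × ℝ) : ℝ × ℝ × ℝ × ℝ :=
  (p.1, p.2.2.1, p.2.1 + p.2.2.2, p.2.2.2)

/-- The vector `Z = (Zˣ, Zᵗ, Zᵘ, Zᵛ)` at the point `p` of the `(x,t,u,v)`-space traces back `W`: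
its image under the transformation `rho` is `W + g ∂/∂V` at `rho p`, for some number `g` (the
equation for `U(X,T)` excludes `V`, so `W` does not prescribe this component). -/
def TracesBack (W : Generator) (p Z : ℝ × ℝ × ℝ × ℝ) : Prop :=
  let q := rho p
  ∃ g : ℝ, fderiv ℝ rho p Z =
    (W.ξ q.1 q.2.1 q.2.2.1, W.τ q.1 q.2.1 q.2.2.1, W.φ q.1 q.2.1 q.2.2.1, g)

/-! ### Actual solutions, and infinitesimal deformations of them -/

/-- `∂/∂x` of a function of `(x,t)`. -/
def px (F : ℝ × ℝ → ℝ) (p : ℝ × ℝ) : ℝ := fderiv ℝ F p (1, 0)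

/-- `∂/∂t` of a function of `(x,t)`. -/
def pt (F : ℝ × ℝ → ℝ) (p : ℝ × ℝ) : ℝ := fderiv ℝ F p (0, 1)

/-- `u` is a smooth solution on `Ω`, with values in `I`, of `u_tt = (c²(u) u_x)_x`. -/
def SolvesWave (c : ℝ → ℝ) (I : Set ℝ) (Ω : Set (ℝ × ℝ)) (u : ℝ × ℝ → ℝ) : Prop :=
  ContDiffOn ℝ ∞ u Ω ∧ (∀ p ∈ Ω, u p ∈ I) ∧
    ∀ p ∈ Ω, pt (pt u) p = px (fun q => c (u q) ^ 2 * px u q) p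

/-- `v` is a smooth potential of `u` on `Ω`: `v_x = u_t`, `v_t = c²(u) u_x`. -/
def IsPotential (c : ℝ → ℝ) (Ω : Set (ℝ × ℝ)) (u v : ℝ × ℝ → ℝ) : Prop :=
  ContDiffOn ℝ ∞ v Ω ∧ ∀ p ∈ Ω, px v p = pt u p ∧ pt v p = c (u p) ^ 2 * px u p

/-- The linearization at `u` of the flux `c²(u) u_x` in the direction `δ`. -/
def linFlux (c : ℝ → ℝ) (u δ : ℝ × ℝ → ℝ) (p : ℝ × ℝ) : ℝ :=
  c (u p) ^ 2 * px δ p + 2 * c (u p) * deriv c (u p) * δ p * px u p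

/-- `δ` solves on `Ω` the linearization of `u_tt = (c²(u) u_x)_x` at `u`. -/
def SolvesLinWave (c : ℝ → ℝ) (Ω : Set (ℝ × ℝ)) (u δ : ℝ × ℝ → ℝ) : Prop :=
  ∀ p ∈ Ω, pt (pt δ) p = px (linFlux c u δ) p

/-- `(δ, ε)` solves on `Ω` the linearization of `v_x = u_t`, `v_t = c²(u) u_x` at `u`. -/
def SolvesLinPotential (c : ℝ → ℝ) (Ω : Set (ℝ × ℝ)) (u δ ε : ℝ × ℝ → ℝ) : Prop :=
  ∀ p ∈ Ω, px ε p = pt δ p ∧ pt ε p = linFlux c u δ p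

/-- `W` yields a symmetry of `u_tt = (c²(u) u_x)_x`. Every solution `u` on a convex open set `Ω`
has a potential `v`; and for every potential `v`, `W` can be traced back to a generator
`Z = (Zˣ, Zᵗ, Zᵘ, Zᵛ)` along `(u,v)` such that the infinitesimal deformation
`δu = Zᵘ - Zˣ u_x - Zᵗ u_t`, `δv = Zᵛ - Zˣ v_x - Zᵗ v_t` solves the linearized potential system
and `δu` solves the linearized wave equation. -/
def YieldsSymmetry (c : ℝ → ℝ) (I : Set ℝ) (W : Generator) : Prop :=
  ∀ (Ω : Set (ℝ × ℝ)) (u : ℝ × ℝ → ℝ), IsOpen Ω → Convex ℝ Ω → SolvesWave c I Ω u →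
    (∃ v, IsPotential c Ω u v) ∧
    ∀ v, IsPotential c Ω u v →
      ∃ Z : ℝ × ℝ → ℝ × ℝ × ℝ × ℝ, ContDiffOn ℝ ∞ Z Ω ∧
        (∀ p ∈ Ω, TracesBack W (p.1, p.2, u p, v p) (Z p)) ∧
        SolvesLinPotential c Ω u
          (fun p => (Z p).2.2.1 - (Z p).1 * px u p - (Z p).2.1 * pt u p)
          (fun p => (Z p).2.2.2 - (Z p).1 * px v p - (Z p).2.1 * pt v p) ∧
        SolvesLinWave c Ω u
          (fun p => (Z p).2.2.1 - (Z p).1 * px u p - (Z p).2.1 * pt u p)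

/-! ### Locality -/

/-- The potential system `v_x = u_t`, `v_t = c²(u) u_x`; the dependent variable with index `0`
is `u`, the one with index `1` is `v`. -/
def potentialSystem (c : ℝ → ℝ) : Fin 2 → Jet (Fin 2) → ℝ :=
  ![fun z => z.2.2 1 1 0 - z.2.2 0 0 1,
    fun z => z.2.2 1 0 1 - c (z.2.2 0 0 0) ^ 2 * z.2.2 0 1 0]

/-- The point `(x,t,u,v)` below a jet. -/
def base (z : Jet (Fin 2)) : ℝ × ℝ × ℝ × ℝ := (z.1, z.2.1, z.2.2 0 0 0, z.2.2 1 0 0)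

/-- The jet of `u` alone. -/
def forget (z : Jet (Fin 2)) : Jet (Fin 1) := (z.1, z.2.1, fun _ => z.2.2 0)

/-- The characteristic `(Zᵘ - Zˣ u_x - Zᵗ u_t, Zᵛ - Zˣ v_x - Zᵗ v_t)` of a generator whose
components are differential functions of `u` and `v`. -/
def characteristic (Z : Jet (Fin 2) → ℝ × ℝ × ℝ × ℝ) : Fin 2 → Jet (Fin 2) → ℝ :=
  ![fun z => (Z z).2.2.1 - (Z z).1 * z.2.2 0 1 0 - (Z z).2.1 * z.2.2 0 0 1,
    fun z => (Z z).2.2.2 - (Z z).1 * z.2.2 1 1 0 - (Z z).2.1 * z.2.2 1 0 1]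

/-- Over the jets in `O`, the symmetry that `W` yields is a local symmetry of
`u_tt = (c²(u) u_x)_x`: `W` can be traced back to a generator `Z` whose components are
differential functions, which is a symmetry of the potential system, and for which the induced
infinitesimal change `δu` is, on solutions, a differential function `q` of `u` alone. (As `u_t` is
generically nonzero, `Zᵗ` is a differential function as soon as `δu` is, so that nothing is lost
by asking this of `Z`; and such a `q` is the characteristic of a symmetry of the wave equation.) -/
def YieldsLocalSymmetryOn (c : ℝ → ℝ) (W : Generator) (O : Set (Jet (Fin 2))) : Prop :=
  ∃ Z : Jet (Fin 2) → ℝ × ℝ × ℝ × ℝ,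
    (IsDifferentialFunctionOn (fun z => (Z z).1) O ∧
      IsDifferentialFunctionOn (fun z => (Z z).2.1) O ∧
      IsDifferentialFunctionOn (fun z => (Z z).2.2.1) O ∧
      IsDifferentialFunctionOn (fun z => (Z z).2.2.2) O) ∧
    (∀ z ∈ O, TracesBack W (base z) (Z z)) ∧
    IsSymmetryOn (potentialSystem c) (characteristic Z) O ∧
    ∃ q : Jet (Fin 1) → ℝ, IsDifferentialFunctionOn q (forget '' O) ∧
      ∀ z ∈ O, z ∈ shell (potentialSystem c) → characteristic Z 0 z = q (forget z)

/-- The point symmetry `W` of the subsystem for `U(X,T)` yields a nonlocal symmetry of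
`u_tt = (c²(u) u_x)_x`, where `u` ranges over `I`: it yields a symmetry, and this symmetry is
not local over any open set of jets that meets the solution manifold. -/
def YieldsNonlocalSymmetry (c : ℝ → ℝ) (I : Set ℝ) (W : Generator) : Prop :=
  IsPointSymmetry c I W ∧ YieldsSymmetry c I W ∧
    ∀ O : Set (Jet (Fin 2)), IsOpen O → (∀ z ∈ O, z.2.2 0 0 0 ∈ I) →
      (O ∩ shell (potentialSystem c)).Nonempty → ¬ YieldsLocalSymmetryOn c W O

end

end NonlinearWave

namespace NonlinearWave

open Filter Topology

noncomputable section

/-! ### Calculus on jet spaces -/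

section JetCalculus

variable {ι : Type}

/-! Tracing back prescribes `Zˣ = ξ`, `Zᵘ = τ` and `Zᵗ + Zᵛ = φ`, so that the only unknown is `ζ =
Zᵗ`. The linearized potential system then becomes two linear equations for `D_x ζ` and `D_t ζ`,
whose determinant, up to sign, is `(1 + c² u_x)² - c² u_t²`. Where it does not vanish, `D_x ζ` is
forced: it is `u_t` for `W₃`, `-(x/3) u_t` for `W₇`, and `3 u_t (t + v) - (u + u_x/u³)` for `W₆`.

Existence of the symmetry: integrate these equations along a given solution. One may take `ζ = t +
v` for `W₃`; `ζ = (3/2)(t + v)² + (1/2) u⁻² - w` with `w_x = u`, `w_t = t + v` for `W₆`; `ζ = -(x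
v)/3 + y` with `y_x = v/3`, `y_t = -u^(-1/3)` for `W₇`. The further potentials `w` and `y` exist
because the forms are closed and `Ω` is convex (`exists_primitive`). The linearized wave equation
follows by cross-differentiation (`yieldsSymmetry_of_determining`).

Nonlocality of `W₃` and `W₇`: here `ξ` and `τ` do not involve `U`, so if `δu` is a function of the
jet of `u`, so is `ζ` wherever `u_t ≠ 0`. But on solutions `D_x ζ = g(x) u_t = g(x) v_x`. On a line
`t = const` the values of `u` and `v` are free (`shellJet`, `shellCurve`), so `v` may be changed by
a small multiple of a step function that is locally constant at both ends of an interval. The jets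
of `u` at the ends do not notice this, whereas the increment of `ζ` across the interval changes: a
contradiction (`not_independent_of_DX_eq_mul`).

Nonlocality of `W₆`: now `δu = (u + u_x/u³)(t + v) - ζ u_t`. A constant shift of `v` by `s` must
change `ζ` by `s (u + u_x/u³)/u_t`, while the formula for `D_x ζ` changes by `3 s u_t`. Hence
`D_x((u + u_x/u³)/u_t) = 3 u_t` on an open set of jets, which fails at generic ones (`w6Generic`).

Point symmetry: the prolonged field applied to the left-hand side `L` of the equation for `U(X,T)`
is an explicit combination of `L`, `D_X L` and `D_T L` (`isPointSymmetry_of_totalDerivs`). -/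

lemma continuous_trunc (n : ℕ) : Continuous (trunc n : Jet ι → _) := by
  unfold trunc; fun_prop

lemma continuous_line (z w : Jet ι) : Continuous fun s : ℝ => z + s • w := by fun_prop

lemma eventually_line_mem {O : Set (Jet ι)} (hO : IsOpen O) {z : Jet ι} (hz : z ∈ O) (w : Jet ι) :
    ∀ᶠ s : ℝ in 𝓝 0, z + s • w ∈ O :=
  (continuous_line z w).continuousAt.eventually_mem (hO.mem_nhds (by simpa using hz))

lemma lineDeriv_congr_of_isOpen {O : Set (Jet ι)} (hO : IsOpen O) {F G : Jet ι → ℝ}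
    (h : ∀ z ∈ O, F z = G z) {z : Jet ι} (hz : z ∈ O) (w : Jet ι) :
    lineDeriv ℝ F z w = lineDeriv ℝ G z w :=
  EventuallyEq.deriv_eq ((eventually_line_mem hO hz w).mono fun _ hs => h _ hs)

lemma hasLineDerivAt_congr_of_isOpen {O : Set (Jet ι)} (hO : IsOpen O) {F G : Jet ι → ℝ}
    (h : ∀ z ∈ O, F z = G z) {z : Jet ι} (hz : z ∈ O) {w : Jet ι} {d : ℝ}
    (hG : HasLineDerivAt ℝ G d z w) : HasLineDerivAt ℝ F d z w :=
  HasDerivAt.congr_of_eventuallyEq hG ((eventually_line_mem hO hz w).mono fun _ hs => h _ hs)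

lemma hasLineDerivAt_fst (z w : Jet ι) : HasLineDerivAt ℝ (fun z : Jet ι => z.1) w.1 z w := by
  have := ((hasDerivAt_id (0 : ℝ)).mul_const w.1).const_add z.1
  simpa [HasLineDerivAt] using this

lemma hasLineDerivAt_snd (z w : Jet ι) :
    HasLineDerivAt ℝ (fun z : Jet ι => z.2.1) w.2.1 z w := by
  have := ((hasDerivAt_id (0 : ℝ)).mul_const w.2.1).const_add z.2.1
  simpa [HasLineDerivAt] using this

lemma hasLineDerivAt_coord (a : ι) (i j : ℕ) (z w : Jet ι) :
    HasLineDerivAt ℝ (fun z : Jet ι => z.2.2 a i j) (w.2.2 a i j) z w := by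
  have := ((hasDerivAt_id (0 : ℝ)).mul_const (w.2.2 a i j)).const_add (z.2.2 a i j)
  simpa [HasLineDerivAt] using this

section Rules

variable {F G : Jet ι → ℝ} {d e : ℝ} {z w : Jet ι}

lemma hasLineDerivAt_add (hF : HasLineDerivAt ℝ F d z w) (hG : HasLineDerivAt ℝ G e z w) :
    HasLineDerivAt ℝ (fun z => F z + G z) (d + e) z w :=
  HasDerivAt.add hF hG

lemma hasLineDerivAt_sub (hF : HasLineDerivAt ℝ F d z w) (hG : HasLineDerivAt ℝ G e z w) :
    HasLineDerivAt ℝ (fun z => F z - G z) (d - e) z w :=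
  HasDerivAt.sub hF hG

lemma hasLineDerivAt_neg (hF : HasLineDerivAt ℝ F d z w) :
    HasLineDerivAt ℝ (fun z => -F z) (-d) z w :=
  HasDerivAt.neg hF

lemma hasLineDerivAt_mul (hF : HasLineDerivAt ℝ F d z w) (hG : HasLineDerivAt ℝ G e z w) :
    HasLineDerivAt ℝ (fun z => F z * G z) (d * G z + F z * e) z w := by
  have := HasDerivAt.mul hF hG
  simp only [zero_smul, add_zero] at this
  exact this

lemma hasLineDerivAt_constMul (r : ℝ) (hF : HasLineDerivAt ℝ F d z w) :
    HasLineDerivAt ℝ (fun z => r * F z) (r * d) z w :=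
  HasDerivAt.const_mul r hF

lemma hasLineDerivAt_comp {g : ℝ → ℝ} {g' : ℝ} (hg : HasDerivAt g g' (F z))
    (hF : HasLineDerivAt ℝ F d z w) : HasLineDerivAt ℝ (fun z => g (F z)) (g' * d) z w :=
  HasDerivAt.comp (0 : ℝ) (by simpa using hg) hF

lemma hasLineDerivAt_pow (hF : HasLineDerivAt ℝ F d z w) (n : ℕ) :
    HasLineDerivAt ℝ (fun z => F z ^ n) (n * F z ^ (n - 1) * d) z w :=
  hasLineDerivAt_comp (hasDerivAt_pow n (F z)) hF

lemma hasLineDerivAt_const (r : ℝ) : HasLineDerivAt ℝ (fun _ : Jet ι => r) 0 z w :=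
  hasDerivAt_const _ _

end Rules

lemma continuousAt_jet {Y : Type*} [TopologicalSpace Y] {γ : Y → Jet ι} {y : Y}
    (h1 : ContinuousAt (fun y => (γ y).1) y) (h2 : ContinuousAt (fun y => (γ y).2.1) y)
    (h3 : ∀ a i j, ContinuousAt (fun y => (γ y).2.2 a i j) y) : ContinuousAt γ y := by
  refine h1.prodMk (h2.prodMk ?_)
  exact continuousAt_pi.2 fun a => continuousAt_pi.2 fun i => continuousAt_pi.2 fun j => h3 a i j

variable [Fintype ι] {F : Jet ι → ℝ} {O : Set (Jet ι)}

lemma hasDerivAt_trunc (n : ℕ) {γ : ℝ → Jet ι} {w : Jet ι} {x : ℝ}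
    (h1 : HasDerivAt (fun y => (γ y).1) w.1 x) (h2 : HasDerivAt (fun y => (γ y).2.1) w.2.1 x)
    (h3 : ∀ a i j, HasDerivAt (fun y => (γ y).2.2 a i j) (w.2.2 a i j) x) :
    HasDerivAt (fun y => trunc n (γ y)) (trunc n w) x := by
  refine h1.prodMk (h2.prodMk ?_)
  refine hasDerivAt_pi.2 fun a => hasDerivAt_pi.2 fun i => hasDerivAt_pi.2 fun j => h3 a i j

lemma IsDifferentialFunctionOn.continuousAt (hF : IsDifferentialFunctionOn F O) (hO : IsOpen O)
    {z : Jet ι} (hz : z ∈ O) : ContinuousAt F z := by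
  obtain ⟨n, V, f, hV, hf, h⟩ := hF
  have h1 : ContinuousAt (fun y => f (trunc n y)) z :=
    ContinuousAt.comp (f := trunc n) (hf.continuousOn.continuousAt (hV.mem_nhds (h z hz).1))
      (continuous_trunc n).continuousAt
  exact h1.congr (eventually_of_mem (hO.mem_nhds hz) fun y hy => (h y hy).2.symm)

/-- The infinite jet space carries no norm, so the chain rule is obtained by factoring `F` through a
finite truncation. This is what allows total derivatives, defined along straight lines, to be
computed along curves of jets. -/
lemma IsDifferentialFunctionOn.hasDerivAt_comp (hF : IsDifferentialFunctionOn F O)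
    (hO : IsOpen O) {γ : ℝ → Jet ι} {w : Jet ι} {x : ℝ} (hx : γ x ∈ O)
    (h1 : HasDerivAt (fun y => (γ y).1) w.1 x) (h2 : HasDerivAt (fun y => (γ y).2.1) w.2.1 x)
    (h3 : ∀ a i j, HasDerivAt (fun y => (γ y).2.2 a i j) (w.2.2 a i j) x) :
    HasDerivAt (fun y => F (γ y)) (lineDeriv ℝ F (γ x) w) x := by
  obtain ⟨n, V, f, hV, hf, h⟩ := hF
  -- Used twice: for the straight line through `γ x`, which identifies the line derivative with the
  -- Fréchet derivative of `f`, and for `γ` itself.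
  have key : ∀ (δ : ℝ → Jet ι) (y : ℝ), δ y = γ x → HasDerivAt (fun y => (δ y).1) w.1 y →
      HasDerivAt (fun y => (δ y).2.1) w.2.1 y →
      (∀ a i j, HasDerivAt (fun y => (δ y).2.2 a i j) (w.2.2 a i j) y) →
      HasDerivAt (fun y => F (δ y)) (fderiv ℝ f (trunc n (γ x)) (trunc n w)) y := by
    intro δ y hy h1 h2 h3
    have hd : HasFDerivAt f (fderiv ℝ f (trunc n (γ x))) (trunc n (δ y)) := by
      rw [hy]
      exact ((hf.contDiffAt (hV.mem_nhds (h _ hx).1)).differentiableAt (by simp)).hasFDerivAt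
    have hc := hd.comp_hasDerivAt y (hasDerivAt_trunc n h1 h2 h3)
    refine hc.congr_of_eventuallyEq ?_
    have : ContinuousAt δ y := continuousAt_jet h1.continuousAt h2.continuousAt
      fun a i j => (h3 a i j).continuousAt
    exact (this.eventually_mem (hO.mem_nhds (by rwa [hy]))).mono fun s hs => (h _ hs).2
  have hl := key (fun s => γ x + s • w) 0 (by simp) (hasLineDerivAt_fst _ _)
    (hasLineDerivAt_snd _ _) fun a i j => hasLineDerivAt_coord a i j _ _
  have : lineDeriv ℝ F (γ x) w = fderiv ℝ f (trunc n (γ x)) (trunc n w) := hl.deriv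
  rw [this]
  exact key γ x rfl h1 h2 h3

lemma IsDifferentialFunctionOn.hasLineDerivAt (hF : IsDifferentialFunctionOn F O)
    (hO : IsOpen O) {z : Jet ι} (hz : z ∈ O) (w : Jet ι) :
    HasLineDerivAt ℝ F (lineDeriv ℝ F z w) z w := by
  have := hF.hasDerivAt_comp hO (γ := fun s : ℝ => z + s • w) (w := w) (x := 0) (by simpa using hz)
    (hasLineDerivAt_fst _ _) (hasLineDerivAt_snd _ _) fun a i j => hasLineDerivAt_coord a i j _ _
  simp only [zero_smul, add_zero] at this
  exact this

lemma IsDifferentialFunctionOn.mono {O' : Set (Jet ι)} (hF : IsDifferentialFunctionOn F O)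
    (h : O' ⊆ O) : IsDifferentialFunctionOn F O' := by
  obtain ⟨n, V, f, hV, hf, hh⟩ := hF
  exact ⟨n, V, f, hV, hf, fun z hz => hh z (h hz)⟩

/-- The order rises by one: the coefficients of a total derivative truncated at order `n` read
coordinates of order `n + 1`, which is all that `hw` asks of the direction field. -/
lemma IsDifferentialFunctionOn.lineDeriv (hF : IsDifferentialFunctionOn F O) (hO : IsOpen O)
    {w : Jet ι → Jet ι}
    (hw : ∀ n, ∃ S : ℝ × ℝ × (ι → Fin (n + 2) → Fin (n + 2) → ℝ) →
        ℝ × ℝ × (ι → Fin (n + 1) → Fin (n + 1) → ℝ), ContDiff ℝ ∞ S ∧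
      ∀ z, trunc n (w z) = S (trunc (n + 1) z)) :
    IsDifferentialFunctionOn (fun z => _root_.lineDeriv ℝ F z (w z)) O := by
  obtain ⟨n, V, f, hV, hf, h⟩ := hF
  obtain ⟨S, hS, hw⟩ := hw n
  let π : ℝ × ℝ × (ι → Fin (n + 2) → Fin (n + 2) → ℝ) →
      ℝ × ℝ × (ι → Fin (n + 1) → Fin (n + 1) → ℝ) :=
    fun y => (y.1, y.2.1, fun a i j => y.2.2 a i.castSucc j.castSucc)
  have hπ : ContDiff ℝ ∞ π := by
    refine contDiff_fst.prodMk ((contDiff_fst.comp contDiff_snd).prodMk ?_)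
    refine contDiff_pi.2 fun a => contDiff_pi.2 fun i => contDiff_pi.2 fun j => ?_
    fun_prop
  refine ⟨n + 1, π ⁻¹' V, fun y => fderiv ℝ f (π y) (S y), hV.preimage hπ.continuous, ?_, ?_⟩
  · have h1 : ContDiffOn ℝ ∞ (fderiv ℝ f) V := hf.fderiv_of_isOpen hV (by simp)
    exact (h1.comp hπ.contDiffOn fun y hy => hy).clm_apply hS.contDiffOn
  · intro z hz
    refine ⟨(h z hz).1, ?_⟩
    have hd : HasFDerivAt f (fderiv ℝ f (trunc n z)) (trunc n (z + (0 : ℝ) • w z)) := by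
      rw [zero_smul, add_zero]
      exact ((hf.contDiffAt (hV.mem_nhds (h _ hz).1)).differentiableAt (by simp)).hasFDerivAt
    have hc := hd.comp_hasDerivAt (0 : ℝ) (hasDerivAt_trunc n (γ := fun s : ℝ => z + s • w z)
      (hasLineDerivAt_fst _ _) (hasLineDerivAt_snd _ _) fun a i j => hasLineDerivAt_coord a i j _ _)
    have := (hc.congr_of_eventuallyEq
      ((eventually_line_mem hO hz (w z)).mono fun s hs => (h _ hs).2)).deriv
    rw [hw] at this
    exact this

lemma IsDifferentialFunctionOn.DX (hF : IsDifferentialFunctionOn F O) (hO : IsOpen O) :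
    IsDifferentialFunctionOn (DX F) O := by
  refine hF.lineDeriv hO (w := fun z => (1, 0, fun a i j => z.2.2 a (i + 1) j)) fun n => ?_
  refine ⟨fun y => (1, 0, fun a i j => y.2.2 a i.succ j.castSucc), ?_, fun z => rfl⟩
  refine contDiff_const.prodMk (contDiff_const.prodMk ?_)
  refine contDiff_pi.2 fun a => contDiff_pi.2 fun i => contDiff_pi.2 fun j => ?_
  fun_prop

lemma IsDifferentialFunctionOn.DT (hF : IsDifferentialFunctionOn F O) (hO : IsOpen O) :
    IsDifferentialFunctionOn (DT F) O := by
  refine hF.lineDeriv hO (w := fun z => (0, 1, fun a i j => z.2.2 a i (j + 1))) fun n => ?_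
  refine ⟨fun y => (0, 1, fun a i j => y.2.2 a i.castSucc j.succ), ?_, fun z => rfl⟩
  refine contDiff_const.prodMk (contDiff_const.prodMk ?_)
  refine contDiff_pi.2 fun a => contDiff_pi.2 fun i => contDiff_pi.2 fun j => ?_
  fun_prop

lemma IsDifferentialFunctionOn.iterate_DX_DT (hF : IsDifferentialFunctionOn F O) (hO : IsOpen O)
    (i j : ℕ) : IsDifferentialFunctionOn (NonlinearWave.DX^[i] (NonlinearWave.DT^[j] F)) O := by
  induction i with
  | zero =>
    induction j with
    | zero => exact hF
    | succ j ih => rw [Function.iterate_succ_apply']; exact ih.DT hO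
  | succ i ih => rw [Function.iterate_succ_apply']; exact ih.DX hO

end JetCalculus

/-! ### Parametrization of the solution manifold of the potential system -/

/-- The flux `c²(u) u_x` on the jet space. -/
def flux (c : ℝ → ℝ) (z : Jet (Fin 2)) : ℝ := c (z.2.2 0 0 0) ^ 2 * z.2.2 0 1 0

/-- The derivative `∂_x^i ∂_t^j` of the flux. -/
def fluxD (c : ℝ → ℝ) (i j : ℕ) : Jet (Fin 2) → ℝ := DX^[i] (DT^[j] (flux c))

/-- The jets at which the zeroth order coordinate of `u` lies in `I`. -/
def domain (I : Set ℝ) : Set (Jet (Fin 2)) := {z | z.2.2 0 0 0 ∈ I}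

lemma isOpen_domain {I : Set ℝ} (hI : IsOpen I) : IsOpen (domain I) :=
  hI.preimage (by fun_prop)

lemma DX_fluxD (c : ℝ → ℝ) (i j : ℕ) : DX (fluxD c i j) = fluxD c (i + 1) j := by
  simp only [fluxD, Function.iterate_succ_apply']

/-! ### How many differentiations in `t` the derivatives of the flux involve -/

section Dependence

/-- `F` depends on the derivatives of `u` with at most `m` differentiations in `t` only. -/
def DependsOnRows (m : ℕ) (F : Jet (Fin 2) → ℝ) : Prop :=
  ∀ z z' : Jet (Fin 2), (∀ i l, l ≤ m → z.2.2 0 i l = z'.2.2 0 i l) → F z = F z'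

lemma DependsOnRows.lineDeriv_eq {m : ℕ} {F : Jet (Fin 2) → ℝ} (hF : DependsOnRows m F)
    {z z' w w' : Jet (Fin 2)} (hz : ∀ i l, l ≤ m → z.2.2 0 i l = z'.2.2 0 i l)
    (hw : ∀ i l, l ≤ m → w.2.2 0 i l = w'.2.2 0 i l) :
    lineDeriv ℝ F z w = lineDeriv ℝ F z' w' := by
  unfold lineDeriv
  congr 1
  funext s
  apply hF
  intro i l hl
  simp [hz i l hl, hw i l hl]

lemma DependsOnRows.DX {m : ℕ} {F : Jet (Fin 2) → ℝ} (hF : DependsOnRows m F) :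
    DependsOnRows m (DX F) :=
  fun _ _ h => hF.lineDeriv_eq h fun i l hl => h (i + 1) l hl

lemma DependsOnRows.DT {m : ℕ} {F : Jet (Fin 2) → ℝ} (hF : DependsOnRows m F) :
    DependsOnRows (m + 1) (DT F) :=
  fun _ _ h => hF.lineDeriv_eq (fun i l hl => h i l (by omega)) fun i l hl => h i (l + 1) (by omega)

/-- `D_x` does not raise the number of differentiations in `t`, and `D_t` raises it by one. This
makes the recursion `rows` sound: the row `n + 2` is computed from rows up to `n`. -/
lemma dependsOnRows_fluxD (c : ℝ → ℝ) (i j : ℕ) : DependsOnRows j (fluxD c i j) := by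
  induction i with
  | zero =>
    induction j with
    | zero =>
      intro z z' h
      simp [fluxD, flux, h]
    | succ j ih =>
      have := ih.DT
      simp only [fluxD, Function.iterate_zero, id_eq, Function.iterate_succ_apply'] at this ⊢
      exact this
  | succ i ih => rw [← DX_fluxD]; exact ih.DX

end Dependence

lemma isDifferentialFunctionOn_fluxD {c : ℝ → ℝ} {I : Set ℝ} (hI : IsOpen I)
    (hc : ContDiffOn ℝ ∞ c I) (i j : ℕ) :
    IsDifferentialFunctionOn (fluxD c i j) (domain I) := by
  refine IsDifferentialFunctionOn.iterate_DX_DT ?_ (isOpen_domain hI) i j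
  refine ⟨1, {y | y.2.2 0 0 0 ∈ I}, fun y => c (y.2.2 0 0 0) ^ 2 * y.2.2 0 1 0,
    hI.preimage (by fun_prop), ?_, fun z hz => ⟨hz, rfl⟩⟩
  have h1 : ContDiff ℝ ∞ fun y : ℝ × ℝ × (Fin 2 → Fin 2 → Fin 2 → ℝ) => y.2.2 0 0 0 := by fun_prop
  have h2 : ContDiff ℝ ∞ fun y : ℝ × ℝ × (Fin 2 → Fin 2 → Fin 2 → ℝ) => y.2.2 0 1 0 := by fun_prop
  exact ((hc.comp h1.contDiffOn fun y hy => hy).pow 2).mul h2.contDiffOn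

/-- The jet at `(x,t)` with the same array of derivatives for both dependent variables. -/
def diagJet (x t : ℝ) (r : ℕ → ℕ → ℝ) : Jet (Fin 2) := (x, t, fun _ => r)

/-- The `n`-th approximation to the derivatives of `u` on a solution of the potential system with
given derivatives `a i = ∂_x^i u` and `w i = ∂_x^i v`: the entries with at most `n + 1`
differentiations in `t` are the final ones. -/
def rows (c : ℝ → ℝ) (x t : ℝ) (a w : ℕ → ℝ) : ℕ → ℕ → ℕ → ℝ
  | 0 => fun i j => if j = 0 then a i else w (i + 1)
  | n + 1 => fun i j =>
      if j = n + 2 then fluxD c (i + 1) n (diagJet x t (rows c x t a w n))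
      else rows c x t a w n i j

/-- The derivatives of `u` on a solution of the potential system with given derivatives
`a i = ∂_x^i u` and `w i = ∂_x^i v`. -/
def uCoord (c : ℝ → ℝ) (x t : ℝ) (a w : ℕ → ℝ) (i j : ℕ) : ℝ := rows c x t a w j i j

/-- The derivatives of `v` on a solution of the potential system with given derivatives
`a i = ∂_x^i u` and `w i = ∂_x^i v`. -/
def vCoord (c : ℝ → ℝ) (x t : ℝ) (a w : ℕ → ℝ) : ℕ → ℕ → ℝ
  | i + 1, j => uCoord c x t a w i (j + 1)
  | 0, 0 => w 0
  | 0, j + 1 => fluxD c 0 j (diagJet x t (uCoord c x t a w))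

/-- The jet on the solution manifold of the potential system with given derivatives
`a i = ∂_x^i u` and `w i = ∂_x^i v`. -/
def shellJet (c : ℝ → ℝ) (x t : ℝ) (a w : ℕ → ℝ) : Jet (Fin 2) :=
  (x, t, ![uCoord c x t a w, vCoord c x t a w])

section ShellJet

variable {c : ℝ → ℝ} {x t : ℝ} {a w : ℕ → ℝ}

/-- The step from stage `n` to `n + 1` alters only the row `n + 2`. Stage `0` already has rows `0`
and `1` right, whence the bound `n + 1` instead of `n`. -/
lemma rows_eq_uCoord {n i j : ℕ} (h : j ≤ n + 1) : rows c x t a w n i j = uCoord c x t a w i j := by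
  have key : ∀ m, j ≤ m → rows c x t a w m i j = uCoord c x t a w i j := by
    intro m hm
    induction m, hm using Nat.le_induction with
    | base => rfl
    | succ m hm ih => rw [← ih]; exact if_neg (by omega)
  rcases Nat.lt_or_ge n j with h' | h'
  · obtain rfl : j = n + 1 := by omega
    rw [← key (n + 1) le_rfl]; exact (if_neg (by omega)).symm
  · exact key n h'

@[simp] lemma uCoord_zero (i : ℕ) : uCoord c x t a w i 0 = a i := by simp [uCoord, rows]

@[simp] lemma uCoord_one (i : ℕ) : uCoord c x t a w i 1 = w (i + 1) := by simp [uCoord, rows]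

lemma fluxD_congr {i j : ℕ} {z z' : Jet (Fin 2)}
    (h : ∀ i l, l ≤ j → z.2.2 0 i l = z'.2.2 0 i l) : fluxD c i j z = fluxD c i j z' :=
  dependsOnRows_fluxD c i j z z' h

/-- The flux derivative reads only rows up to `n`, which are final at stage `n`, so the approximate
array in the recursion may be replaced by the full one. -/
lemma uCoord_add_two (i n : ℕ) :
    uCoord c x t a w i (n + 2) = fluxD c (i + 1) n (shellJet c x t a w) := by
  rw [← rows_eq_uCoord le_rfl]
  refine (if_pos rfl).trans ?_
  exact fluxD_congr fun i l hl => rows_eq_uCoord (by omega)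

@[simp] lemma vCoord_zero (i : ℕ) : vCoord c x t a w i 0 = w i := by
  cases i <;> simp [vCoord]

lemma vCoord_succ (i n : ℕ) :
    vCoord c x t a w i (n + 1) = fluxD c i n (shellJet c x t a w) := by
  cases i with
  | zero => exact fluxD_congr fun i l _ => rfl
  | succ i => exact uCoord_add_two i n

end ShellJet

section Shell

variable {c : ℝ → ℝ} {I : Set ℝ}

lemma iterate_DX_DT_potentialSystem_zero (i j : ℕ) (z : Jet (Fin 2)) :
    (DX^[i] (DT^[j] (potentialSystem c 0))) z = z.2.2 1 (i + 1) j - z.2.2 0 i (j + 1) := by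
  have hT : ∀ j, DT^[j] (potentialSystem c 0) =
      fun z => z.2.2 1 1 j - z.2.2 0 0 (j + 1) := by
    intro j
    induction j with
    | zero => rfl
    | succ j ih =>
      rw [Function.iterate_succ_apply', ih]
      funext z
      exact (hasLineDerivAt_sub (hasLineDerivAt_coord 1 1 j z _)
        (hasLineDerivAt_coord 0 0 (j + 1) z _)).lineDeriv
  induction i generalizing z with
  | zero => rw [Function.iterate_zero, id_eq, hT]
  | succ i ih =>
    rw [Function.iterate_succ_apply', funext ih]
    exact (hasLineDerivAt_sub (hasLineDerivAt_coord 1 (i + 1) j z _)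
        (hasLineDerivAt_coord 0 i (j + 1) z _)).lineDeriv

lemma iterate_DX_DT_potentialSystem_one (hI : IsOpen I) (hc : ContDiffOn ℝ ∞ c I) (i j : ℕ)
    {z : Jet (Fin 2)} (hz : z ∈ domain I) :
    (DX^[i] (DT^[j] (potentialSystem c 1))) z = z.2.2 1 i (j + 1) - fluxD c i j z := by
  have hD := fun i j => isDifferentialFunctionOn_fluxD hI hc i j
  have hO := isOpen_domain hI
  have hT : ∀ j, ∀ z ∈ domain I, (DT^[j] (potentialSystem c 1)) z =
      z.2.2 1 0 (j + 1) - fluxD c 0 j z := by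
    intro j
    induction j with
    | zero => intro z _; rfl
    | succ j ih =>
      intro z hz
      rw [Function.iterate_succ_apply']
      refine (lineDeriv_congr_of_isOpen hO ih hz _).trans ?_
      refine (hasLineDerivAt_sub (hasLineDerivAt_coord 1 0 (j + 1) z _)
        ((hD 0 j).hasLineDerivAt hO hz _)).lineDeriv.trans ?_
      simp only [fluxD, Function.iterate_zero, id_eq, Function.iterate_succ_apply']
      rfl
  induction i generalizing z with
  | zero => exact hT j z hz
  | succ i ih =>
    rw [Function.iterate_succ_apply']
    refine (lineDeriv_congr_of_isOpen hO (fun z hz => ih hz) hz _).trans ?_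
    refine (hasLineDerivAt_sub (hasLineDerivAt_coord 1 i (j + 1) z _)
        ((hD i j).hasLineDerivAt hO hz _)).lineDeriv.trans ?_
    rw [← DX_fluxD]
    rfl

/-- The differential consequences decouple into explicit formulas: one family exchanges an
`x`-derivative of `v` for a `t`-derivative of `u`, the other solves for the `t`-derivatives of `v`.
-/
lemma mem_shell_potentialSystem_iff (hI : IsOpen I) (hc : ContDiffOn ℝ ∞ c I)
    {z : Jet (Fin 2)} (hz : z ∈ domain I) :
    z ∈ shell (potentialSystem c) ↔ (∀ i j, z.2.2 1 (i + 1) j = z.2.2 0 i (j + 1)) ∧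
      ∀ i j, z.2.2 1 i (j + 1) = fluxD c i j z := by
  simp only [shell, Set.mem_ofPred_eq, Fin.forall_fin_two, iterate_DX_DT_potentialSystem_zero,
    iterate_DX_DT_potentialSystem_one hI hc _ _ hz, sub_eq_zero]

lemma shellJet_mem_shell (hI : IsOpen I) (hc : ContDiffOn ℝ ∞ c I) (x t : ℝ) {a w : ℕ → ℝ}
    (ha : a 0 ∈ I) : shellJet c x t a w ∈ shell (potentialSystem c) := by
  rw [mem_shell_potentialSystem_iff hI hc (by simpa [domain, shellJet] using ha)]
  exact ⟨fun i j => rfl, fun i j => vCoord_succ i j⟩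

/-- Strong induction on the number `j` of differentiations in `t`: two of them on `u` become one
`x`-derivative of the flux, which contains two fewer. Thus the pure `x`-derivatives of `u` and `v`
are coordinates on the solution manifold. -/
lemma eq_shellJet (hI : IsOpen I) (hc : ContDiffOn ℝ ∞ c I) {z : Jet (Fin 2)}
    (hz : z ∈ domain I) (h : z ∈ shell (potentialSystem c)) :
    z = shellJet c z.1 z.2.1 (fun i => z.2.2 0 i 0) (fun i => z.2.2 1 i 0) := by
  rw [mem_shell_potentialSystem_iff hI hc hz] at h
  obtain ⟨h0, h1⟩ := h
  set y := shellJet c z.1 z.2.1 (fun i => z.2.2 0 i 0) (fun i => z.2.2 1 i 0) with hy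
  have hu : ∀ j i, z.2.2 0 i j = y.2.2 0 i j := by
    intro j
    induction j using Nat.strong_induction_on with
    | _ j ih =>
      intro i
      match j with
      | 0 => simp [hy, shellJet]
      | 1 => rw [← h0]; simp [hy, shellJet]
      | n + 2 =>
        rw [← h0, h1]
        refine Eq.trans ?_ (uCoord_add_two i n).symm
        exact fluxD_congr fun i l hl => ih l (by omega) i
  have hv : ∀ i j, z.2.2 1 i j = y.2.2 1 i j := by
    intro i j
    cases j with
    | zero => simp [hy, shellJet]
    | succ j =>
      rw [h1]
      refine Eq.trans ?_ (vCoord_succ i j).symm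
      exact fluxD_congr fun i l _ => hu l i
  refine Prod.ext rfl (Prod.ext rfl ?_)
  funext b i j
  fin_cases b
  · exact hu j i
  · exact hv i j

end Shell

section Families

variable {c : ℝ → ℝ} {I : Set ℝ}

lemma continuousAt_shellJet (hI : IsOpen I) (hc : ContDiffOn ℝ ∞ c I)
    {Y : Type*} [TopologicalSpace Y] {y : Y} {x t : Y → ℝ} {a w : Y → ℕ → ℝ}
    (hx : ContinuousAt x y) (ht : ContinuousAt t y) (ha : ∀ i, ContinuousAt (fun y => a y i) y)
    (hw : ∀ i, ContinuousAt (fun y => w y i) y) (hy : a y 0 ∈ I) :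
    ContinuousAt (fun y => shellJet c (x y) (t y) (a y) (w y)) y := by
  have hF : ∀ (i j : ℕ) (γ : Y → Jet (Fin 2)), (γ y).2.2 0 0 0 ∈ I → ContinuousAt γ y →
      ContinuousAt (fun y => fluxD c i j (γ y)) y := fun i j γ h hγ =>
    ContinuousAt.comp (f := γ)
      ((isDifferentialFunctionOn_fluxD hI hc i j).continuousAt (isOpen_domain hI) h) hγ
  have hr : ∀ n i j, ContinuousAt (fun y => rows c (x y) (t y) (a y) (w y) n i j) y := by
    intro n
    induction n with
    | zero =>
      intro i j
      by_cases hj : j = 0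
      · simpa [rows, hj] using ha i
      · simpa [rows, hj] using hw (i + 1)
    | succ n ih =>
      intro i j
      by_cases hj : j = n + 2
      · simp only [rows, hj, if_true]
        refine hF _ _ (fun y => diagJet (x y) (t y) (rows c (x y) (t y) (a y) (w y) n)) ?_
          (continuousAt_jet hx ht fun _ i j => ih i j)
        simpa [diagJet, rows_eq_uCoord] using hy
      · simpa only [rows, hj, if_false] using ih i j
  have hu : ∀ i j, ContinuousAt (fun y => uCoord c (x y) (t y) (a y) (w y) i j) y :=
    fun i j => hr j i j
  refine continuousAt_jet hx ht fun b i j => ?_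
  fin_cases b
  · exact hu i j
  · match i, j with
    | i + 1, j => exact hu i (j + 1)
    | 0, 0 => exact hw 0
    | 0, j + 1 =>
      refine hF _ _ (fun y => diagJet (x y) (t y) (uCoord c (x y) (t y) (a y) (w y))) ?_
        (continuousAt_jet hx ht fun _ i j => hu i j)
      simpa [diagJet] using hy

/-- Along the jets on the solution manifold that belong to functions `a`, `w` of `x`, the derivative
of a differential function is its total derivative. -/
lemma hasDerivAt_comp_shellJet (hI : IsOpen I) (hc : ContDiffOn ℝ ∞ c I) {a w : ℝ → ℕ → ℝ}
    {x t : ℝ} (ha : ∀ i, HasDerivAt (fun y => a y i) (a x (i + 1)) x)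
    (hw : ∀ i, HasDerivAt (fun y => w y i) (w x (i + 1)) x) (hx : a x 0 ∈ I)
    {F : Jet (Fin 2) → ℝ} {O : Set (Jet (Fin 2))} (hF : IsDifferentialFunctionOn F O)
    (hO : IsOpen O) (hxO : shellJet c x t (a x) (w x) ∈ O) :
    HasDerivAt (fun y => F (shellJet c y t (a y) (w y)))
      (DX F (shellJet c x t (a x) (w x))) x := by
  have hflux : ∀ (i j : ℕ) (γ : ℝ → ℕ → ℕ → ℝ), (γ x) 0 0 ∈ I →
      (∀ i j, HasDerivAt (fun y => γ y i j) (γ x (i + 1) j) x) →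
      HasDerivAt (fun y => fluxD c i j (diagJet y t (γ y)))
        (fluxD c (i + 1) j (diagJet x t (γ x))) x := by
    intro i j γ h hγ
    rw [← DX_fluxD]
    exact (isDifferentialFunctionOn_fluxD hI hc i j).hasDerivAt_comp (isOpen_domain hI)
      (γ := fun y => diagJet y t (γ y)) h (hasDerivAt_id x) (hasDerivAt_const x t)
      fun _ i j => hγ i j
  have hr : ∀ n i j, HasDerivAt (fun y => rows c y t (a y) (w y) n i j)
      (rows c x t (a x) (w x) n (i + 1) j) x := by
    intro n
    induction n with
    | zero =>
      intro i j
      by_cases hj : j = 0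
      · simpa [rows, hj] using ha i
      · simpa [rows, hj] using hw (i + 1)
    | succ n ih =>
      intro i j
      by_cases hj : j = n + 2
      · simp only [rows, hj, if_true]
        refine hflux _ _ (fun y => rows c y t (a y) (w y) n) ?_ ih
        simpa [rows_eq_uCoord] using hx
      · simpa only [rows, hj, if_false] using ih i j
  have hu : ∀ i j, HasDerivAt (fun y => uCoord c y t (a y) (w y) i j)
      (uCoord c x t (a x) (w x) (i + 1) j) x := fun i j => hr j i j
  refine hF.hasDerivAt_comp hO (γ := fun y => shellJet c y t (a y) (w y)) hxO (hasDerivAt_id x)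
    (hasDerivAt_const x t) fun b i j => ?_
  fin_cases b
  · exact hu i j
  · match i, j with
    | i + 1, j => exact hu i (j + 1)
    | 0, 0 => exact hw 0
    | 0, j + 1 =>
      refine (hflux 0 j (fun y => uCoord c y t (a y) (w y)) (by simpa using hx) hu).congr_deriv ?_
      refine Eq.trans ?_ (vCoord_succ (c := c) (x := x) (t := t) (a := a x) (w := w x) 1 j).symm
      exact fluxD_congr fun i l _ => rfl

end Families

/-! ### Curves on the solution manifold -/

/-- A multiple of `(y - x)^n` corrects the `n`-th derivative at `x` and leaves the lower ones alone.
Finitely many derivatives suffice, so Borel's theorem is not needed. -/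
lemma exists_contDiff_iteratedDeriv_eq (b : ℕ → ℝ) (x : ℝ) (n : ℕ) :
    ∃ A : ℝ → ℝ, ContDiff ℝ ∞ A ∧ ∀ i < n, iteratedDeriv i A x = b i := by
  induction n with
  | zero => exact ⟨fun _ => 0, contDiff_const, by simp⟩
  | succ n ih =>
    obtain ⟨A, hA, h⟩ := ih
    set k := (b n - iteratedDeriv n A x) / n.factorial with hk
    have hP : ContDiff ℝ ∞ fun y : ℝ => k * (y - x) ^ n := by fun_prop
    have hd : ∀ i, iteratedDeriv i (fun y => A y + k * (y - x) ^ n) x =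
        iteratedDeriv i A x + k * (if i = n then (n.factorial : ℝ) else 0) := by
      intro i
      rw [iteratedDeriv_fun_add (hA.of_le (by exact_mod_cast le_top)).contDiffAt
        (hP.of_le (by exact_mod_cast le_top)).contDiffAt, iteratedDeriv_const_mul_field,
        iteratedDeriv_comp_sub_const i (fun y : ℝ => y ^ n) x]
      simp only [sub_self, iteratedDeriv_fun_pow_zero]
      split_ifs <;> simp
    refine ⟨fun y => A y + k * (y - x) ^ n, hA.add hP, fun i hi => ?_⟩
    rw [hd]
    rcases Nat.lt_succ_iff_lt_or_eq.1 hi with hi | rfl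
    · simp [h i hi, hi.ne]
    · have : (i.factorial : ℝ) ≠ 0 := by positivity
      simp only [if_true, hk]
      field_simp
      ring

lemma hasDerivAt_iteratedDeriv {A : ℝ → ℝ} (hA : ContDiff ℝ ∞ A) (i : ℕ) (x : ℝ) :
    HasDerivAt (iteratedDeriv i A) (iteratedDeriv (i + 1) A x) x := by
  rw [iteratedDeriv_succ]
  exact (hA.differentiable_iteratedDeriv i (by exact_mod_cast ENat.natCast_lt_top i) x).hasDerivAt

lemma exists_not_mem_of_isOpen {U : Set ℝ} (hU : IsOpen U) (hne : U.Nonempty) {s : Set ℝ}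
    (hs : s.Finite) : ∃ x ∈ U, x ∉ s := by
  obtain ⟨x, hx, hx'⟩ := (hs.countable.dense_compl ℝ).exists_mem_open hU hne
  exact ⟨x, hx', hx⟩

/-- The potential itself, `w 0`, never enters the derivatives of `u`; only its `x`-derivatives do,
through `u_t = v_x`. -/
lemma uCoord_congr {c : ℝ → ℝ} {x t : ℝ} {a w w' : ℕ → ℝ} (h : ∀ i, w (i + 1) = w' (i + 1)) :
    uCoord c x t a w = uCoord c x t a w' := by
  have : ∀ n, rows c x t a w n = rows c x t a w' n := by
    intro n
    induction n with
    | zero => simp only [rows, h]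
    | succ n ih => simp only [rows, ih]
  funext i j
  exact congrFun (congrFun (this j) i) j

/-- The curve of jets on the solution manifold that belong to the values `A` of `u` and
`V + s P` of `v` at the time `t`. -/
def shellCurve (c : ℝ → ℝ) (t : ℝ) (A V P : ℝ → ℝ) (s x : ℝ) : Jet (Fin 2) :=
  shellJet c x t (fun i => iteratedDeriv i A x)
    (fun i => iteratedDeriv i V x + s * iteratedDeriv i P x)

section Curves

variable {c : ℝ → ℝ} {I : Set ℝ} (hI : IsOpen I) (hc : ContDiffOn ℝ ∞ c I)
include hI hc

/-- Genericity device: a free coordinate of the solution manifold can be moved slightly inside `O`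
so as to avoid finitely many bad values. -/
lemma exists_mem_shellJet_of_finite {O : Set (Jet (Fin 2))} (hO : IsOpen O)
    {x t : ℝ → ℝ} {a w : ℝ → ℕ → ℝ} (hx : Continuous x) (ht : Continuous t)
    (ha : ∀ i, Continuous fun s => a s i) (hw : ∀ i, Continuous fun s => w s i) {s₀ : ℝ}
    (h0 : a s₀ 0 ∈ I) (hs : shellJet c (x s₀) (t s₀) (a s₀) (w s₀) ∈ O) {B : Set ℝ}
    (hB : B.Finite) : ∃ s ∉ B, shellJet c (x s) (t s) (a s) (w s) ∈ O := by
  have h := (continuousAt_shellJet hI hc hx.continuousAt ht.continuousAt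
    (fun i => (ha i).continuousAt) (fun i => (hw i).continuousAt) h0).eventually_mem
    (hO.mem_nhds hs)
  obtain ⟨U, hU, hUo, hsU⟩ := eventually_nhds_iff.1 h
  obtain ⟨s, hs, hs'⟩ := exists_not_mem_of_isOpen hUo ⟨s₀, hsU⟩ hB
  exact ⟨s, hs', hU s hs⟩

/-- In the product topology, jets of functions matching more and more derivatives at `x` converge to
the given jet, so they eventually lie in the open set `O`. The perturbation `P` is irrelevant at
parameter `0`. -/
lemma exists_shellCurve_mem {O : Set (Jet (Fin 2))} (hO : IsOpen O) {x t : ℝ} {a w : ℕ → ℝ}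
    (ha : a 0 ∈ I) (h : shellJet c x t a w ∈ O) :
    ∃ A V : ℝ → ℝ, ContDiff ℝ ∞ A ∧ ContDiff ℝ ∞ V ∧ A x ∈ I ∧
      ∀ P, shellCurve c t A V P 0 x ∈ O := by
  choose A hA hA' using fun n => exists_contDiff_iteratedDeriv_eq a x n
  choose V hV hV' using fun n => exists_contDiff_iteratedDeriv_eq w x n
  have hlim : ∀ (b : ℕ → ℝ) (B : ℕ → ℝ → ℝ), (∀ n, ∀ i < n, iteratedDeriv i (B n) x = b i) →
      Tendsto (fun n i => iteratedDeriv i (B n) x) atTop (𝓝 b) := fun b B hB =>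
    tendsto_pi_nhds.2 fun i => tendsto_const_nhds.congr'
      ((eventually_gt_atTop i).mono fun n hn => (hB n i hn).symm)
  have hcont : ContinuousAt (fun y : (ℕ → ℝ) × (ℕ → ℝ) => shellJet c x t y.1 y.2) (a, w) :=
    continuousAt_shellJet hI hc continuousAt_const continuousAt_const
      (fun i => by fun_prop) (fun i => by fun_prop) ha
  have hev := ((hlim a A hA').prodMk_nhds (hlim w V hV')).eventually
    (hcont.eventually_mem (hO.mem_nhds h))
  obtain ⟨n, hn, hn0⟩ := (hev.and (eventually_gt_atTop 0)).exists
  refine ⟨A n, V n, hA n, hV n, ?_, fun P => ?_⟩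
  · have := hA' n 0 hn0
    rw [iteratedDeriv_zero] at this
    rwa [this]
  · simpa [shellCurve] using hn

variable {A V P : ℝ → ℝ} (hA : ContDiff ℝ ∞ A) (hV : ContDiff ℝ ∞ V) (hP : ContDiff ℝ ∞ P)
include hA hV hP

lemma continuousAt_shellCurve (t s : ℝ) {x : ℝ} (hx : A x ∈ I) :
    ContinuousAt (fun y : ℝ × ℝ => shellCurve c t A V P y.1 y.2) (s, x) := by
  have h : ∀ {B : ℝ → ℝ}, ContDiff ℝ ∞ B → ∀ i, Continuous (iteratedDeriv i B) := fun hB i =>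
    hB.continuous_iteratedDeriv i (by exact_mod_cast le_top)
  refine continuousAt_shellJet hI hc continuousAt_snd continuousAt_const (fun i => ?_)
    (fun i => ?_) (by simpa using hx)
  · exact ((h hA i).comp continuous_snd).continuousAt
  · exact (((h hV i).comp continuous_snd).add
      (continuous_fst.mul ((h hP i).comp continuous_snd))).continuousAt

lemma hasDerivAt_comp_shellCurve (t s : ℝ) {x : ℝ} (hx : A x ∈ I) {F : Jet (Fin 2) → ℝ}
    {O : Set (Jet (Fin 2))} (hF : IsDifferentialFunctionOn F O) (hO : IsOpen O)
    (hxO : shellCurve c t A V P s x ∈ O) :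
    HasDerivAt (fun y => F (shellCurve c t A V P s y)) (DX F (shellCurve c t A V P s x)) x := by
  refine hasDerivAt_comp_shellJet hI hc (a := fun x i => iteratedDeriv i A x)
    (w := fun x i => iteratedDeriv i V x + s * iteratedDeriv i P x)
    (fun i => hasDerivAt_iteratedDeriv hA i x) (fun i => ?_) (by simpa using hx) hF hO hxO
  exact (hasDerivAt_iteratedDeriv hV i x).add ((hasDerivAt_iteratedDeriv hP i x).const_mul s)

end Curves

/-- Where all derivatives of `P` vanish, the perturbation only shifts the value of `v`, and the jet
of `u` cannot detect it. -/
lemma forget_shellCurve_eq {c : ℝ → ℝ} {t : ℝ} {A V P : ℝ → ℝ} {x : ℝ} (s s' : ℝ)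
    (h : ∀ i, iteratedDeriv (i + 1) P x = 0) :
    forget (shellCurve c t A V P s x) = forget (shellCurve c t A V P s' x) := by
  have : uCoord c x t (fun i => iteratedDeriv i A x)
      (fun i => iteratedDeriv i V x + s * iteratedDeriv i P x) =
      uCoord c x t (fun i => iteratedDeriv i A x)
      (fun i => iteratedDeriv i V x + s' * iteratedDeriv i P x) :=
    uCoord_congr fun i => by simp [h i]
  simp only [forget, shellCurve, shellJet, Matrix.cons_val_zero, this]

/-- A smooth monotone function that is locally constant at both ends of an interval, but not
constant on it. -/
lemma exists_step (x r : ℝ) (hr : 0 < r) : ∃ P : ℝ → ℝ, ContDiff ℝ ∞ P ∧ Monotone P ∧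
    P (x - r) = 0 ∧ P (x + r) = 1 ∧ (∀ i, iteratedDeriv (i + 1) P (x - r) = 0) ∧
    ∀ i, iteratedDeriv (i + 1) P (x + r) = 0 := by
  set P : ℝ → ℝ := fun y => Real.smoothTransition ((y - x) * (2 / r)) with hP
  have h0 : P =ᶠ[𝓝 (x - r)] fun _ => 0 := by
    filter_upwards [Iio_mem_nhds (show x - r < x by linarith)] with y hy
    exact Real.smoothTransition.zero_of_nonpos
      (mul_nonpos_of_nonpos_of_nonneg (by linarith [Set.mem_Iio.1 hy]) (by positivity))
  have h1 : P =ᶠ[𝓝 (x + r)] fun _ => 1 := by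
    filter_upwards [Ioi_mem_nhds (show x + r / 2 < x + r by linarith)] with y hy
    refine Real.smoothTransition.one_of_one_le ?_
    have h2 : r / 2 ≤ y - x := by linarith [Set.mem_Ioi.1 hy]
    calc (1 : ℝ) = r / 2 * (2 / r) := by field_simp
      _ ≤ (y - x) * (2 / r) := by gcongr
  refine ⟨P, Real.smoothTransition.contDiff.comp (by fun_prop), fun y z hyz => ?_,
    h0.eq_of_nhds, h1.eq_of_nhds, fun i => ?_, fun i => ?_⟩
  · exact Real.smoothTransition.monotone (by gcongr)
  · rw [h0.iteratedDeriv_eq, iteratedDeriv_const]; simp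
  · rw [h1.iteratedDeriv_eq, iteratedDeriv_const]; simp

/-! ### The step-function argument for dependence on `v` -/

section Obstructions

variable {c : ℝ → ℝ} {I : Set ℝ} (hI : IsOpen I) (hc : ContDiffOn ℝ ∞ c I)
  {O : Set (Jet (Fin 2))} (hO : IsOpen O) (hOI : O ⊆ domain I) {ζ : Jet (Fin 2) → ℝ}
  (hζ : IsDifferentialFunctionOn ζ O)
include hI hc hO hOI hζ

/-- A differential function with total derivative `g(x) u_t` depends on `v`. -/
lemma not_independent_of_DX_eq_mul (hne : (O ∩ shell (potentialSystem c)).Nonempty)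
    {g : ℝ → ℝ} (hg : Continuous g) (hg0 : ∀ z ∈ O, g z.1 ≠ 0)
    (hDX : ∀ z ∈ O, z ∈ shell (potentialSystem c) → DX ζ z = g z.1 * z.2.2 0 0 1)
    (hind : ∀ z ∈ O, ∀ z' ∈ O, z ∈ shell (potentialSystem c) → z' ∈ shell (potentialSystem c) →
      forget z = forget z' → ζ z = ζ z') : False := by
  obtain ⟨z, hz, hzs⟩ := hne
  have hzI : z.2.2 0 0 0 ∈ I := hOI hz
  rw [eq_shellJet hI hc hzI hzs] at hz
  set t := z.2.1
  set x := z.1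
  obtain ⟨A, V, hA, hV, hAx, hmem⟩ := exists_shellCurve_mem hI hc hO (a := fun i => z.2.2 0 i 0) hzI hz
  have hgx : g x ≠ 0 := hg0 (shellCurve c t A V 0 0 x) (hmem 0)
  have hAI : ∀ {P s y}, shellCurve c t A V P s y ∈ O → A y ∈ I := fun h => by
    simpa [domain, shellCurve, shellJet] using hOI h
  have hshell : ∀ {P s y}, shellCurve c t A V P s y ∈ O →
      shellCurve c t A V P s y ∈ shell (potentialSystem c) := fun h =>
    shellJet_mem_shell hI hc _ _ (by simpa using hAI h)
  -- An interval around `x` on which the unperturbed curve stays in `O` and `g` keeps the sign of `g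
  -- x`, with a quantitative lower bound.
  have hnear : ∀ᶠ y in 𝓝 x, shellCurve c t A V 0 0 y ∈ O ∧ g x ^ 2 / 2 < g x * g y := by
    refine Eventually.and ?_ ?_
    · have h1 := continuousAt_shellCurve hI hc hA hV (P := 0) contDiff_const t 0 hAx
      have h2 : ContinuousAt (fun y => shellCurve c t A V 0 0 y) x :=
        ContinuousAt.comp (f := fun y : ℝ => ((0 : ℝ), y)) h1 (by fun_prop)
      exact h2.eventually_mem (hO.mem_nhds (hmem 0))
    · have : Continuous fun y => g x * g y := by fun_prop
      refine this.continuousAt.eventually (lt_mem_nhds ?_)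
      have : 0 < g x ^ 2 := by positivity
      nlinarith
  obtain ⟨r, hr, hball⟩ := Metric.nhds_basis_closedBall.eventually_iff.1 hnear
  rw [Real.closedBall_eq_Icc] at hball
  obtain ⟨P, hP, hPm, hPl, hPr, hPl', hPr'⟩ := exists_step x r hr
  have hzero : ∀ y, shellCurve c t A V P 0 y = shellCurve c t A V 0 0 y := by
    intro y; simp [shellCurve]
  -- Compactness of the interval gives one `s > 0` for which the entire perturbed curve stays in
  -- `O`.
  have htube : ∀ᶠ s in 𝓝 (0 : ℝ), ∀ y ∈ Set.Icc (x - r) (x + r), shellCurve c t A V P s y ∈ O := by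
    refine isCompact_Icc.eventually_forall_of_forall_eventually fun y hy => ?_
    have hy0 : shellCurve c t A V P 0 y ∈ O := by rw [hzero]; exact (hball hy).1
    exact (continuousAt_shellCurve hI hc hA hV hP t 0 (hAI hy0)).eventually_mem (hO.mem_nhds hy0)
  obtain ⟨s, hs, hs0⟩ := ((htube.filter_mono nhdsWithin_le_nhds).and
    (self_mem_nhdsWithin (s := Set.Ioi (0 : ℝ)))).exists
  have hs0 : 0 < s := hs0
  have h0 : ∀ y ∈ Set.Icc (x - r) (x + r), shellCurve c t A V P 0 y ∈ O := fun y hy => by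
    rw [hzero]; exact (hball hy).1
  -- On the curves `u_t` is `V' + s P'`, so the difference of the two values of `ζ` has derivative
  -- `s g(y) P'(y)`. The subtracted term is the guaranteed part of its growth after multiplication
  -- by `g x`; hence `D` increases.
  set D : ℝ → ℝ := fun y => g x * (ζ (shellCurve c t A V P s y) - ζ (shellCurve c t A V P 0 y)) -
    s * (g x ^ 2 / 2) * P y with hD
  have hder : ∀ y ∈ Set.Icc (x - r) (x + r),
      HasDerivAt D ((g x * g y - g x ^ 2 / 2) * (s * deriv P y)) y := by
    intro y hy
    have hd : ∀ {s'}, shellCurve c t A V P s' y ∈ O →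
        HasDerivAt (fun y => ζ (shellCurve c t A V P s' y))
          (g y * (iteratedDeriv 1 V y + s' * iteratedDeriv 1 P y)) y := fun {s'} h => by
      have := hasDerivAt_comp_shellCurve hI hc hA hV hP t s' (hAI h) hζ hO h
      rw [hDX _ h (hshell h)] at this
      simpa [shellCurve, shellJet] using this
    have hPd : HasDerivAt P (deriv P y) y := (hP.differentiable (by simp) y).hasDerivAt
    refine ((((hd (hs y hy)).sub (hd (h0 y hy))).const_mul (g x)).sub
      (hPd.const_mul (s * (g x ^ 2 / 2)))).congr_deriv ?_
    rw [iteratedDeriv_one, iteratedDeriv_one]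
    ring
  have hmono : MonotoneOn D (Set.Icc (x - r) (x + r)) := by
    refine monotoneOn_of_deriv_nonneg (convex_Icc _ _)
      (fun y hy => (hder y hy).continuousAt.continuousWithinAt)
      (fun y hy => (hder y (interior_subset hy)).differentiableAt.differentiableWithinAt)
      fun y hy => ?_
    rw [(hder y (interior_subset hy)).deriv]
    have h1 := (hball (interior_subset hy)).2
    have h2 : 0 ≤ deriv P y := hPm.deriv_nonneg
    exact mul_nonneg (by linarith) (by positivity)
  have hl : x - r ∈ Set.Icc (x - r) (x + r) := ⟨le_rfl, by linarith⟩
  have hm : x + r ∈ Set.Icc (x - r) (x + r) := ⟨by linarith, le_rfl⟩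
  have hle := hmono hl hm (by linarith)
  -- At both ends `P` is locally constant, so the two values of `ζ` agree there. Then `D` drops from
  -- `0` to `-s (g x)²/2`, against monotonicity.
  have e1 := hind _ (hs _ hl) _ (h0 _ hl) (hshell (hs _ hl)) (hshell (h0 _ hl))
    (forget_shellCurve_eq s 0 hPl')
  have e2 := hind _ (hs _ hm) _ (h0 _ hm) (hshell (hs _ hm)) (hshell (h0 _ hm))
    (forget_shellCurve_eq s 0 hPr')
  simp only [hD, e1, e2, hPl, hPr, sub_self, mul_zero, mul_one] at hle
  have : 0 < s * (g x ^ 2 / 2) := by positivity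
  linarith

end Obstructions

/-! ### Determining equations for generators of local symmetries -/

lemma fderiv_rho (p Z : ℝ × ℝ × ℝ × ℝ) :
    fderiv ℝ rho p Z = (Z.1, Z.2.2.1, Z.2.1 + Z.2.2.2, Z.2.2.2) := by
  let M : ℝ × ℝ × ℝ × ℝ →L[ℝ] ℝ × ℝ := .snd ℝ ℝ _ ∘L .snd ℝ ℝ _
  have h1 : HasFDerivAt (fun p : ℝ × ℝ × ℝ × ℝ => p.1) (.fst ℝ ℝ _) p := hasFDerivAt_fst
  have h2 : HasFDerivAt (fun p : ℝ × ℝ × ℝ × ℝ => p.2.1) (.fst ℝ ℝ _ ∘L .snd ℝ ℝ _) p :=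
    hasFDerivAt_fst.comp p hasFDerivAt_snd
  have h3 : HasFDerivAt (fun p : ℝ × ℝ × ℝ × ℝ => p.2.2.1) (.fst ℝ ℝ _ ∘L M) p :=
    hasFDerivAt_fst.comp p M.hasFDerivAt
  have h4 : HasFDerivAt (fun p : ℝ × ℝ × ℝ × ℝ => p.2.2.2) (.snd ℝ ℝ _ ∘L M) p :=
    hasFDerivAt_snd.comp p M.hasFDerivAt
  have h : HasFDerivAt rho _ p := h1.prodMk (h3.prodMk ((h2.add h4).prodMk h4))
  rw [h.fderiv]
  rfl

lemma tracesBack_iff (W : Generator) (x t u v : ℝ) (Z : ℝ × ℝ × ℝ × ℝ) :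
    TracesBack W (x, t, u, v) Z ↔ Z.1 = W.ξ x u (t + v) ∧ Z.2.2.1 = W.τ x u (t + v) ∧
      Z.2.1 + Z.2.2.2 = W.φ x u (t + v) := by
  simp [TracesBack, rho, fderiv_rho]

section Determining

variable {c : ℝ → ℝ} {I : Set ℝ} (hI : IsOpen I) (hc : ContDiffOn ℝ ∞ c I)
include hI hc

lemma hasDerivAt_of_contDiffOn {u : ℝ} (hu : u ∈ I) : HasDerivAt c (deriv c u) u :=
  ((hc.contDiffAt (hI.mem_nhds hu)).differentiableAt (by simp)).hasDerivAt

lemma hasDerivAt_deriv_of_contDiffOn {u : ℝ} (hu : u ∈ I) :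
    HasDerivAt (deriv c) (deriv (deriv c) u) u :=
  hasDerivAt_of_contDiffOn hI (hc.deriv_of_isOpen hI (by simp)) hu

lemma hasLineDerivAt_flux {z : Jet (Fin 2)} (hz : z.2.2 0 0 0 ∈ I) (w : Jet (Fin 2)) :
    HasLineDerivAt ℝ (flux c)
      (2 * c (z.2.2 0 0 0) * deriv c (z.2.2 0 0 0) * z.2.2 0 1 0 * w.2.2 0 0 0 +
        c (z.2.2 0 0 0) ^ 2 * w.2.2 0 1 0) z w := by
  have h := hasLineDerivAt_mul (hasLineDerivAt_pow (hasLineDerivAt_comp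
    (hasDerivAt_of_contDiffOn hI hc hz) (hasLineDerivAt_coord 0 0 0 z w)) 2)
    (hasLineDerivAt_coord 0 1 0 z w)
  exact HasDerivAt.congr_deriv h (by push_cast; ring)

/-- The first consequences of the potential system on the solution manifold. -/
lemma shell_relations {z : Jet (Fin 2)} (hz : z ∈ domain I)
    (h : z ∈ shell (potentialSystem c)) :
    (z.2.2 1 1 0 = z.2.2 0 0 1 ∧ z.2.2 1 2 0 = z.2.2 0 1 1 ∧ z.2.2 1 1 1 = z.2.2 0 0 2) ∧
    z.2.2 1 0 1 = c (z.2.2 0 0 0) ^ 2 * z.2.2 0 1 0 ∧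
    z.2.2 1 1 1 = 2 * c (z.2.2 0 0 0) * deriv c (z.2.2 0 0 0) * z.2.2 0 1 0 * z.2.2 0 1 0 +
      c (z.2.2 0 0 0) ^ 2 * z.2.2 0 2 0 ∧
    z.2.2 1 0 2 = 2 * c (z.2.2 0 0 0) * deriv c (z.2.2 0 0 0) * z.2.2 0 1 0 * z.2.2 0 0 1 +
      c (z.2.2 0 0 0) ^ 2 * z.2.2 0 1 1 := by
  rw [mem_shell_potentialSystem_iff hI hc hz] at h
  obtain ⟨h0, h1⟩ := h
  refine ⟨⟨h0 0 0, h0 1 0, h0 0 1⟩, h1 0 0, (h1 1 0).trans ?_, (h1 0 1).trans ?_⟩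
  · exact (hasLineDerivAt_flux hI hc hz _).lineDeriv
  · exact (hasLineDerivAt_flux hI hc hz _).lineDeriv

/-- The total derivative of `Zᵗ` on the solution manifold, in terms of the total derivatives of
`Zˣ`, `Zᵘ` and `Zᵗ + Zᵛ`. -/
lemma DX_time_component {O : Set (Jet (Fin 2))} (hO : IsOpen O) (hOI : O ⊆ domain I)
    {Z : Jet (Fin 2) → ℝ × ℝ × ℝ × ℝ}
    (hζ : IsDifferentialFunctionOn (fun z => (Z z).2.1) O)
    (hS : IsSymmetryOn (potentialSystem c) (characteristic Z) O)
    {ξ τ φ : Jet (Fin 2) → ℝ} (hξ : ∀ z ∈ O, (Z z).1 = ξ z) (hτ : ∀ z ∈ O, (Z z).2.2.1 = τ z)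
    (hφ : ∀ z ∈ O, (Z z).2.1 + (Z z).2.2.2 = φ z)
    {z : Jet (Fin 2)} (hz : z ∈ O) (hzs : z ∈ shell (potentialSystem c))
    {ξx ξt τx τt φx φt : ℝ}
    (hξx : HasLineDerivAt ℝ ξ ξx z (1, 0, fun a i j => z.2.2 a (i + 1) j))
    (hξt : HasLineDerivAt ℝ ξ ξt z (0, 1, fun a i j => z.2.2 a i (j + 1)))
    (hτx : HasLineDerivAt ℝ τ τx z (1, 0, fun a i j => z.2.2 a (i + 1) j))
    (hτt : HasLineDerivAt ℝ τ τt z (0, 1, fun a i j => z.2.2 a i (j + 1)))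
    (hφx : HasLineDerivAt ℝ φ φx z (1, 0, fun a i j => z.2.2 a (i + 1) j))
    (hφt : HasLineDerivAt ℝ φ φt z (0, 1, fun a i j => z.2.2 a i (j + 1)))
    {u ux ut k k' : ℝ} (hu : z.2.2 0 0 0 = u) (hux : z.2.2 0 1 0 = ux) (hut : z.2.2 0 0 1 = ut)
    (hk : c u = k) (hk' : deriv c u = k') :
    ((1 + k ^ 2 * ux) ^ 2 - k ^ 2 * ut ^ 2) * DX (fun z => (Z z).2.1) z =
      -(1 + k ^ 2 * ux) * (τt - ξt * ux - φx + ξx * ut) -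
        ut * (k ^ 2 * (τx - ξx * ux) + 2 * k * k' * ux * τ z - φt + ξt * ut) := by
  subst hu hux hut hk hk'
  obtain ⟨⟨r1, r2, r3⟩, r4, r5, r6⟩ := shell_relations hI hc (hOI hz) hzs
  have hQ0 : ∀ z ∈ O, characteristic Z 0 z =
      τ z - ξ z * z.2.2 0 1 0 - (Z z).2.1 * z.2.2 0 0 1 := fun z hz => by
    simp [characteristic, hξ z hz, hτ z hz]
  have hQ1 : ∀ z ∈ O, characteristic Z 1 z =
      φ z - (Z z).2.1 - ξ z * z.2.2 1 1 0 - (Z z).2.1 * z.2.2 1 0 1 := fun z hz => by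
    simp [characteristic, hξ z hz, ← hφ z hz]
  have hd0 := fun {w ξw τw} (hξw : HasLineDerivAt ℝ ξ ξw z w) (hτw : HasLineDerivAt ℝ τ τw z w) =>
    (hasLineDerivAt_congr_of_isOpen hO hQ0 hz (hasLineDerivAt_sub (hasLineDerivAt_sub hτw
      (hasLineDerivAt_mul hξw (hasLineDerivAt_coord 0 1 0 z w)))
      (hasLineDerivAt_mul (hζ.hasLineDerivAt hO hz w) (hasLineDerivAt_coord 0 0 1 z w)))).lineDeriv
  have hd1 := fun {w ξw φw} (hξw : HasLineDerivAt ℝ ξ ξw z w) (hφw : HasLineDerivAt ℝ φ φw z w) =>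
    (hasLineDerivAt_congr_of_isOpen hO hQ1 hz (hasLineDerivAt_sub (hasLineDerivAt_sub
      (hasLineDerivAt_sub hφw (hζ.hasLineDerivAt hO hz w))
      (hasLineDerivAt_mul hξw (hasLineDerivAt_coord 1 1 0 z w)))
      (hasLineDerivAt_mul (hζ.hasLineDerivAt hO hz w) (hasLineDerivAt_coord 1 0 1 z w)))).lineDeriv
  have hX0 : DX (characteristic Z 0) z = _ := hd0 hξx hτx
  have hT0 : DT (characteristic Z 0) z = _ := hd0 hξt hτt
  have hX1 : DX (characteristic Z 1) z = _ := hd1 hξx hφx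
  have hT1 : DT (characteristic Z 1) z = _ := hd1 hξt hφt
  -- `s0` and `s1` are the two linearized equations at the jet `z`.
  have s0 : DX (characteristic Z 1) z - DT (characteristic Z 0) z = 0 := by
    rw [← hS z hz hzs 0]
    exact (hasLineDerivAt_sub (hasLineDerivAt_coord 1 1 0 z (prolong (characteristic Z) z))
      (hasLineDerivAt_coord 0 0 1 z (prolong (characteristic Z) z))).lineDeriv.symm
  have s1 : DT (characteristic Z 1) z - (2 * c (z.2.2 0 0 0) * deriv c (z.2.2 0 0 0) *
      z.2.2 0 1 0 * characteristic Z 0 z +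
        c (z.2.2 0 0 0) ^ 2 * DX (characteristic Z 0) z) = 0 := by
    rw [← hS z hz hzs 1]
    exact (hasLineDerivAt_sub (hasLineDerivAt_coord 1 0 1 z (prolong (characteristic Z) z))
      (hasLineDerivAt_flux hI hc (hOI hz) (prolong (characteristic Z) z))).lineDeriv.symm
  rw [hQ0 z hz] at s1
  rw [hX1, hT0] at s0
  rw [hT1, hX0] at s1
  have eX : lineDeriv ℝ (fun z => (Z z).2.1) z (1, 0, fun a i j => z.2.2 a (i + 1) j) =
    DX (fun z => (Z z).2.1) z := rfl
  have eT : lineDeriv ℝ (fun z => (Z z).2.1) z (0, 1, fun a i j => z.2.2 a i (j + 1)) =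
    DT (fun z => (Z z).2.1) z := rfl
  simp only [eX, eT, zero_add, Nat.reduceAdd, r1, r2, r3, r4, r6] at s0 s1
  rw [r3] at r5
  rw [r5] at s0 s1
  -- Cramer's rule: with these multipliers `D_t ζ` cancels and `D_x ζ` acquires the determinant as
  -- its coefficient.
  linear_combination (-(1 + c (z.2.2 0 0 0) ^ 2 * z.2.2 0 1 0)) * s0 - z.2.2 0 0 1 * s1

end Determining

/-! ### Restriction to generic jets -/

section NotLocal

variable {c : ℝ → ℝ} {I : Set ℝ} (hI : IsOpen I) (hc : ContDiffOn ℝ ∞ c I)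
  {O : Set (Jet (Fin 2))} (hO : IsOpen O) (hOI : O ⊆ domain I) {ζ : Jet (Fin 2) → ℝ}
  (hζ : IsDifferentialFunctionOn ζ O) (hne : (O ∩ shell (potentialSystem c)).Nonempty)

/-- The determinant of the system that determines the total derivatives of `Zᵗ`. -/
def determinant (c : ℝ → ℝ) (z : Jet (Fin 2)) : ℝ :=
  (1 + c (z.2.2 0 0 0) ^ 2 * z.2.2 0 1 0) ^ 2 - c (z.2.2 0 0 0) ^ 2 * z.2.2 0 0 1 ^ 2

include hc in
lemma continuousOn_determinant : ContinuousOn (determinant c) (domain I) := by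
  have h : ContinuousOn (fun z : Jet (Fin 2) => c (z.2.2 0 0 0)) (domain I) :=
    hc.continuousOn.comp (f := fun z : Jet (Fin 2) => z.2.2 0 0 0) (by fun_prop) fun z hz => hz
  have h1 : ∀ i j, ContinuousOn (fun z : Jet (Fin 2) => z.2.2 0 i j) (domain I) :=
    fun i j => Continuous.continuousOn (by fun_prop)
  exact ((continuousOn_const.add ((h.pow 2).mul (h1 1 0))).pow 2).sub
    ((h.pow 2).mul ((h1 0 1).pow 2))

/-- As a quadratic in `u_t` the determinant has the two listed roots. Where `c` vanishes it equals
`1`, so the value of the division by zero does no harm. -/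
lemma determinant_ne_zero {c : ℝ → ℝ} {z : Jet (Fin 2)}
    (h : z.2.2 0 0 1 ∉ ({(1 + c (z.2.2 0 0 0) ^ 2 * z.2.2 0 1 0) / c (z.2.2 0 0 0),
      -((1 + c (z.2.2 0 0 0) ^ 2 * z.2.2 0 1 0) / c (z.2.2 0 0 0))} : Set ℝ)) :
    determinant c z ≠ 0 := by
  unfold determinant
  simp only [Set.mem_insert_iff, Set.mem_singleton_iff, not_or] at h
  obtain ⟨h1, h2⟩ := h
  intro h0
  rcases eq_or_ne (c (z.2.2 0 0 0)) 0 with hk | hk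
  · rw [hk] at h0; norm_num at h0
  · have h3 : (c (z.2.2 0 0 0) * z.2.2 0 0 1) ^ 2 = (1 + c (z.2.2 0 0 0) ^ 2 * z.2.2 0 1 0) ^ 2 := by
      linarith
    rcases sq_eq_sq_iff_eq_or_eq_neg.1 h3 with h3 | h3
    · exact h1 (by rw [eq_div_iff hk]; linarith)
    · exact h2 (by rw [← neg_div, eq_div_iff hk]; linarith)

-- Reduction to the step-function argument: `O` is cut down to the open set where `g(x)`, `u_t` and
-- the determinant are nonzero. It still meets the solution manifold, because `x` and `v_x = u_t`
-- are free there.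
include hI hc hO hOI hζ hne in
lemma not_local_of_DX_eq_mul {g : ℝ → ℝ} (hg : Continuous g) (hg0 : {x | g x = 0}.Finite)
    (hDX : ∀ z ∈ O, z ∈ shell (potentialSystem c) → determinant c z ≠ 0 →
      DX ζ z = g z.1 * z.2.2 0 0 1)
    (hind : ∀ z ∈ O, ∀ z' ∈ O, z ∈ shell (potentialSystem c) → z' ∈ shell (potentialSystem c) →
      forget z = forget z' → z.2.2 0 0 1 ≠ 0 → ζ z = ζ z') : False := by
  set N : Set (Jet (Fin 2)) := {z | g z.1 ≠ 0 ∧ z.2.2 0 0 1 ≠ 0} with hN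
  have hNo : IsOpen N := (isOpen_ne_fun (by fun_prop) (by fun_prop)).inter
    (isOpen_ne_fun (by fun_prop) (by fun_prop))
  have hO' : IsOpen (O ∩ N ∩ determinant c ⁻¹' {0}ᶜ) := by
    refine ContinuousOn.isOpen_inter_preimage ?_ (hO.inter hNo) isOpen_compl_singleton
    exact (continuousOn_determinant hc).mono fun z hz => hOI hz.1
  have hsub : O ∩ N ∩ determinant c ⁻¹' {0}ᶜ ⊆ O := fun z hz => hz.1.1
  refine not_independent_of_DX_eq_mul hI hc hO' (hsub.trans hOI) (hζ.mono hsub) ?_ hg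
    (fun z hz => hz.1.2.1) (fun z hz hzs => ?_)
    fun z hz z' hz' hzs hzs' h => hind z hz.1.1 z' hz'.1.1 hzs hzs' h hz.1.2.2
  · obtain ⟨z, hz, hzs⟩ := hne
    have hzI : z.2.2 0 0 0 ∈ I := hOI hz
    rw [eq_shellJet hI hc hzI hzs] at hz
    set a : ℕ → ℝ := fun i => z.2.2 0 i 0 with ha
    set w : ℕ → ℝ := fun i => z.2.2 1 i 0 with hw
    obtain ⟨x, hx, hxO⟩ := exists_mem_shellJet_of_finite hI hc hO (x := id) (s₀ := z.1)
      (t := fun _ => z.2.1) (a := fun _ => a) (w := fun _ => w)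
      continuous_id continuous_const (fun _ => continuous_const) (fun _ => continuous_const)
      hzI hz hg0
    -- The coordinate `w 1 = v_x` is `u_t` on the solution manifold; `0` and the two roots of the
    -- determinant are to be avoided.
    obtain ⟨s, hs, hsO⟩ := exists_mem_shellJet_of_finite hI hc hO (x := fun _ => x) (s₀ := w 1)
      (t := fun _ => z.2.1) (a := fun _ => a) (w := fun s => Function.update w 1 s)
      continuous_const continuous_const (fun _ => continuous_const)
      (fun i => Continuous.comp (g := fun w : ℕ → ℝ => w i) (continuous_apply i)
        (continuous_const.update 1 continuous_id))
      hzI (by simpa using hxO)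
      (B := {0, (1 + c (a 0) ^ 2 * a 1) / c (a 0), -((1 + c (a 0) ^ 2 * a 1) / c (a 0))})
      (by simp)
    simp only [Set.mem_insert_iff, not_or] at hs
    refine ⟨_, ⟨⟨hsO, hx, ?_⟩, ?_⟩, shellJet_mem_shell hI hc _ _ hzI⟩
    · simpa [shellJet] using hs.1
    · refine determinant_ne_zero ?_
      simpa [shellJet] using hs.2
  · exact hDX z hz.1.1 hzs hz.2

end NotLocal

lemma hasLineDerivAt_time_add {z : Jet (Fin 2)} (w : Jet (Fin 2)) :
    HasLineDerivAt ℝ (fun z : Jet (Fin 2) => z.2.1 + z.2.2 1 0 0) (w.2.1 + w.2.2 1 0 0) z w :=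
  hasLineDerivAt_add (hasLineDerivAt_snd z w) (hasLineDerivAt_coord 1 0 0 z w)

lemma tracesBack_base {W : Generator} {O : Set (Jet (Fin 2))} {Z : Jet (Fin 2) → ℝ × ℝ × ℝ × ℝ}
    (h : ∀ z ∈ O, TracesBack W (base z) (Z z)) :
    (∀ z ∈ O, (Z z).1 = W.ξ z.1 (z.2.2 0 0 0) (z.2.1 + z.2.2 1 0 0)) ∧
    (∀ z ∈ O, (Z z).2.2.1 = W.τ z.1 (z.2.2 0 0 0) (z.2.1 + z.2.2 1 0 0)) ∧
    ∀ z ∈ O, (Z z).2.1 + (Z z).2.2.2 = W.φ z.1 (z.2.2 0 0 0) (z.2.1 + z.2.2 1 0 0) := by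
  have h' := fun z hz => (tracesBack_iff W _ _ _ _ _).1 (h z hz)
  exact ⟨fun z hz => (h' z hz).1, fun z hz => (h' z hz).2.1, fun z hz => (h' z hz).2.2⟩

lemma coord_eq_of_forget_eq {z z' : Jet (Fin 2)} (h : forget z = forget z') :
    z.1 = z'.1 ∧ z.2.1 = z'.2.1 ∧ z.2.2 0 = z'.2.2 0 := by
  simp only [forget, Prod.mk.injEq] at h
  exact ⟨h.1, h.2.1, congrFun h.2.2 0⟩

/-- If the coefficients `ξ` and `τ` do not involve `U`, then `Zᵗ` does not depend on `v`. -/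
lemma time_component_eq {W : Generator} (hξ : ∀ X T U U', W.ξ X T U = W.ξ X T U')
    (hτ : ∀ X T U U', W.τ X T U = W.τ X T U') {O : Set (Jet (Fin 2))}
    {Z : Jet (Fin 2) → ℝ × ℝ × ℝ × ℝ} (hZ : ∀ z ∈ O, TracesBack W (base z) (Z z))
    {q : Jet (Fin 1) → ℝ} {z z' : Jet (Fin 2)} (hz : z ∈ O) (hz' : z' ∈ O)
    (hq : characteristic Z 0 z = q (forget z)) (hq' : characteristic Z 0 z' = q (forget z'))
    (h : forget z = forget z') (hut : z.2.2 0 0 1 ≠ 0) : (Z z).2.1 = (Z z').2.1 := by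
  obtain ⟨h1, h2, -⟩ := tracesBack_base hZ
  obtain ⟨e1, -, e3⟩ := coord_eq_of_forget_eq h
  rw [← h, ← hq] at hq'
  simp only [characteristic, Matrix.cons_val_zero, h1 z hz, h1 z' hz', h2 z hz, h2 z' hz'] at hq'
  rw [← e1, ← e3, hξ _ _ _ (z.2.1 + z.2.2 1 0 0), hτ _ _ _ (z.2.1 + z.2.2 1 0 0)] at hq'
  exact mul_right_cancel₀ hut (by linarith)

/-! ### Nonlocality -/

theorem not_yieldsLocalSymmetryOn_W₃ {c C : ℝ → ℝ} {I : Set ℝ} (hI : IsOpen I)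
    (hc : ContDiffOn ℝ ∞ c I) (hC : ∀ u ∈ I, HasDerivAt C (c u ^ 2) u) {O : Set (Jet (Fin 2))}
    (hO : IsOpen O) (hOI : O ⊆ domain I) (hne : (O ∩ shell (potentialSystem c)).Nonempty) :
    ¬ YieldsLocalSymmetryOn c (W₃ C) O := by
  rintro ⟨Z, ⟨-, hζ, -, -⟩, hZ, hS, q, -, hq⟩
  -- For `W₃` the determining equations give `D_x Zᵗ = u_t`.
  refine not_local_of_DX_eq_mul hI hc hO hOI hζ hne (g := fun _ => 1) continuous_const (by simp)
    (fun z hz hzs hΔ => ?_) fun z hz z' hz' hzs hzs' h hut =>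
      time_component_eq (W := W₃ C) (fun _ _ _ _ => rfl) (fun _ _ _ _ => rfl) hZ hz hz'
        (hq z hz hzs) (hq z' hz' hzs') h hut
  obtain ⟨h1, h2, h3⟩ := tracesBack_base hZ
  obtain ⟨⟨r1, -, -⟩, r4, -, -⟩ := shell_relations hI hc (hOI hz) hzs
  have hξ := fun w => hasLineDerivAt_add (hasLineDerivAt_fst z w)
    (hasLineDerivAt_comp (hC _ (hOI hz)) (hasLineDerivAt_coord 0 0 0 z w))
  have key := DX_time_component hI hc hO hOI hζ hS h1 h2 h3 hz hzs (hξ _) (hξ _)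
    (hasLineDerivAt_const 0) (hasLineDerivAt_const 0) (hasLineDerivAt_time_add _)
    (hasLineDerivAt_time_add _) rfl rfl rfl rfl rfl
  simp only [zero_add, r1, r4, W₃] at key
  refine mul_left_cancel₀ hΔ ?_
  simp only [determinant]
  linear_combination key

/-! ### Nonlocality for `c = u^(-2/3)` -/

/-- With `u = s³` all the powers and derivatives that occur become rational in `s`, so that the
identities for `W₇` are within reach of `field_simp` and `ring`. -/
lemma exists_cube_root {u : ℝ} (hu : 0 < u) : ∃ s : ℝ, 0 < s ∧ u = s ^ 3 ∧
    u ^ (-(1 / 3) : ℝ) = s⁻¹ ∧ u ^ (2 / 3 : ℝ) = s ^ 2 ∧ u ^ (-(2 / 3) : ℝ) = (s ^ 2)⁻¹ ∧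
    HasDerivAt (fun u : ℝ => u ^ (-(1 / 3) : ℝ)) (-(1 / 3) * (s ^ 4)⁻¹) u ∧
    HasDerivAt (fun u : ℝ => u ^ (2 / 3 : ℝ)) (2 / 3 * s⁻¹) u ∧
    HasDerivAt (fun u : ℝ => u ^ (-(2 / 3) : ℝ)) (-(2 / 3) * (s ^ 5)⁻¹) u ∧
    deriv (deriv fun u : ℝ => u ^ (-(2 / 3) : ℝ)) u = 10 / 9 * (s ^ 8)⁻¹ := by
  set s := u ^ (1 / 3 : ℝ) with hs
  have hs0 : 0 < s := by positivity
  have hn : ∀ (e : ℝ) (n : ℕ), e = n / 3 → u ^ e = s ^ n := fun e n he => by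
    rw [hs, ← Real.rpow_natCast, ← Real.rpow_mul hu.le, he]
    congr 1; ring
  have hi : ∀ (e : ℝ) (n : ℕ), e = -(n / 3) → u ^ e = (s ^ n)⁻¹ := fun e n he => by
    rw [← hn (n / 3) n rfl, ← Real.rpow_neg hu.le, he]
  refine ⟨s, hs0, ?_, ?_, ?_, ?_, ?_, ?_, ?_, ?_⟩
  · rw [← hn 1 3 (by norm_num), Real.rpow_one]
  · simpa using hi (-(1 / 3)) 1 (by norm_num)
  · exact hn _ 2 (by norm_num)
  · exact hi _ 2 (by norm_num)
  · rw [← hi (-(1 / 3) - 1) 4 (by norm_num)]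
    exact Real.hasDerivAt_rpow_const (Or.inl hu.ne')
  · have := hi (2 / 3 - 1) 1 (by norm_num)
    rw [pow_one] at this
    rw [← this]
    exact Real.hasDerivAt_rpow_const (Or.inl hu.ne')
  · rw [← hi (-(2 / 3) - 1) 5 (by norm_num)]
    exact Real.hasDerivAt_rpow_const (Or.inl hu.ne')
  · have h1 : deriv (fun u : ℝ => u ^ (-(2 / 3) : ℝ)) =ᶠ[𝓝 u]
        fun u => -(2 / 3) * u ^ (-(2 / 3) - 1 : ℝ) := by
      filter_upwards [lt_mem_nhds hu] with y hy
      exact (Real.hasDerivAt_rpow_const (Or.inl hy.ne')).deriv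
    rw [h1.deriv_eq, ((Real.hasDerivAt_rpow_const (Or.inl hu.ne')).const_mul _).deriv,
      hi _ 8 (by norm_num)]
    ring

lemma contDiffOn_rpow_pos (e : ℝ) : ContDiffOn ℝ ∞ (fun u : ℝ => u ^ e) {u | 0 < u} :=
  fun _ hu => (contDiffAt_id.rpow_const_of_ne (ne_of_gt hu)).contDiffWithinAt

theorem not_yieldsLocalSymmetryOn_W₇ {O : Set (Jet (Fin 2))}
    (hO : IsOpen O) (hOI : O ⊆ domain {u | 0 < u})
    (hne : (O ∩ shell (potentialSystem fun u => u ^ (-(2 / 3) : ℝ))).Nonempty) :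
    ¬ YieldsLocalSymmetryOn (fun u => u ^ (-(2 / 3) : ℝ)) W₇ O := by
  have hI : IsOpen {u : ℝ | 0 < u} := isOpen_lt continuous_const continuous_id
  have hc := contDiffOn_rpow_pos (-(2 / 3))
  rintro ⟨Z, ⟨-, hζ, -, -⟩, hZ, hS, q, -, hq⟩
  -- For `W₇` the determining equations give `D_x Zᵗ = -(x/3) u_t`; the factor vanishes only at `x =
  -- 0`.
  refine not_local_of_DX_eq_mul hI hc hO hOI hζ hne (g := fun x => -(x / 3)) (by fun_prop)
    (by simp)
    (fun z hz hzs hΔ => ?_) fun z hz z' hz' hzs hzs' h hut =>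
      time_component_eq (W := W₇) (fun _ _ _ _ => rfl) (fun _ _ _ _ => rfl) hZ hz hz'
        (hq z hz hzs) (hq z' hz' hzs') h hut
  obtain ⟨h1, h2, h3⟩ := tracesBack_base hZ
  obtain ⟨s, hs0, hs, e1, e2, e3, d1, d2, d3, -⟩ := exists_cube_root (u := z.2.2 0 0 0) (hOI hz)
  have hξ := fun w => hasLineDerivAt_sub (hasLineDerivAt_mul (hasLineDerivAt_fst z w)
    (hasLineDerivAt_comp d1 (hasLineDerivAt_coord 0 0 0 z w)))
    (hasLineDerivAt_constMul (1 / 3) (hasLineDerivAt_pow (hasLineDerivAt_fst z w) 2))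
  have hτ := fun w => hasLineDerivAt_sub (hasLineDerivAt_mul (hasLineDerivAt_fst z w)
    (hasLineDerivAt_coord 0 0 0 z w))
    (hasLineDerivAt_constMul 3 (hasLineDerivAt_comp d2 (hasLineDerivAt_coord 0 0 0 z w)))
  have key := DX_time_component hI hc hO hOI hζ hS
    (fun z hz => (h1 z hz).trans (by simp only [W₇]; ring)) h2 h3 hz hzs (hξ _) (hξ _)
    (hτ _) (hτ _) (hasLineDerivAt_const 0) (hasLineDerivAt_const 0) rfl rfl rfl e3 d3.deriv
  refine mul_left_cancel₀ hΔ ?_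
  simp only [determinant]
  simp only [zero_add, W₇, e1, e2] at key
  rw [e3]
  refine key.trans ?_
  rw [hs]
  field_simp
  ring

/-! ### Nonlocality for `c = u⁻²` -/

lemma hasDerivAt_zpow_neg_two {u : ℝ} (hu : u ≠ 0) :
    HasDerivAt (fun u : ℝ => u ^ (-2 : ℤ)) (-2 * (u ^ 3)⁻¹) u := by
  refine (hasDerivAt_zpow (-2) u (Or.inl hu)).congr_deriv ?_
  norm_num

lemma deriv_deriv_zpow_neg_two {u : ℝ} (hu : u ≠ 0) :
    deriv (deriv fun u : ℝ => u ^ (-2 : ℤ)) u = 6 * (u ^ 4)⁻¹ := by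
  have h1 : deriv (fun u : ℝ => u ^ (-2 : ℤ)) =ᶠ[𝓝 u] fun u => -2 * u ^ (-3 : ℤ) := by
    filter_upwards [isOpen_ne.mem_nhds hu] with y hy
    rw [(hasDerivAt_zpow_neg_two hy).deriv]
    rfl
  rw [h1.deriv_eq, ((hasDerivAt_zpow (-3) u (Or.inl hu)).const_mul _).deriv]
  norm_num
  rw [← mul_assoc]
  norm_num

lemma contDiffOn_zpow_neg_two : ContDiffOn ℝ ∞ (fun u : ℝ => u ^ (-2 : ℤ)) {u | u ≠ 0} := by
  have h : (fun u : ℝ => u ^ (-2 : ℤ)) = fun u => (u ^ 2)⁻¹ := by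
    funext u; rfl
  rw [h]
  intro u hu
  exact ((contDiffAt_id.pow 2).inv (pow_ne_zero 2 hu)).contDiffWithinAt

/-- The jets at which `D_x(u (1 + u⁻⁴ u_x) / u_t) ≠ 3 u_t`, with denominators cleared. -/
def w6Generic (z : Jet (Fin 2)) : ℝ :=
  3 * z.2.2 0 0 1 ^ 3 + (z.2.2 0 0 0 + z.2.2 0 1 0 / z.2.2 0 0 0 ^ 3) * z.2.2 0 1 1 -
    z.2.2 0 0 1 * (z.2.2 0 1 0 + z.2.2 0 2 0 / z.2.2 0 0 0 ^ 3 -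
      3 * z.2.2 0 1 0 ^ 2 / z.2.2 0 0 0 ^ 4)

lemma continuousOn_w6Generic : ContinuousOn w6Generic (domain {u | u ≠ 0}) := by
  have h1 : ∀ i j, ContinuousOn (fun z : Jet (Fin 2) => z.2.2 0 i j) (domain {u | u ≠ 0}) :=
    fun i j => Continuous.continuousOn (by fun_prop)
  have hd : ∀ n, ∀ z ∈ domain {u | u ≠ 0}, z.2.2 0 0 0 ^ n ≠ 0 := fun n z hz => pow_ne_zero n hz
  exact ((continuousOn_const.mul ((h1 0 1).pow 3)).add
    (((h1 0 0).add ((h1 1 0).div ((h1 0 0).pow 3) (hd 3))).mul (h1 1 1))).sub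
    ((h1 0 1).mul (((h1 1 0).add ((h1 2 0).div ((h1 0 0).pow 3) (hd 3))).sub
      ((continuousOn_const.mul ((h1 1 0).pow 2)).div ((h1 0 0).pow 4) (hd 4))))

/-- Three free coordinates are moved in turn: `u_x`, to make `u + u_x/u³` nonzero; `u_t = v_x`, to
avoid `0` and the roots of the determinant; finally `u_tx = v_xx`, in which `w6Generic` is affine
with slope `u + u_x/u³`. -/
lemma exists_mem_shell_w6Generic {c : ℝ → ℝ} (hc : ContDiffOn ℝ ∞ c {u | u ≠ 0})
    {O : Set (Jet (Fin 2))} (hO : IsOpen O) (hOI : O ⊆ domain {u | u ≠ 0})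
    (hne : (O ∩ shell (potentialSystem c)).Nonempty) :
    ∃ z ∈ O, z ∈ shell (potentialSystem c) ∧ z.2.2 0 0 1 ≠ 0 ∧ determinant c z ≠ 0 ∧
      w6Generic z ≠ 0 := by
  have hI : IsOpen {u : ℝ | u ≠ 0} := isOpen_ne
  obtain ⟨z, hz, hzs⟩ := hne
  have hzI : z.2.2 0 0 0 ∈ {u : ℝ | u ≠ 0} := hOI hz
  rw [eq_shellJet hI hc hzI hzs] at hz
  set a : ℕ → ℝ := fun i => z.2.2 0 i 0 with ha
  set w : ℕ → ℝ := fun i => z.2.2 1 i 0 with hw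
  have hupd : ∀ (b : ℕ → ℝ) (n i : ℕ), Continuous fun s : ℝ => Function.update b n s i :=
    fun b n i => Continuous.comp (g := fun w : ℕ → ℝ => w i) (continuous_apply i)
      (continuous_const.update n continuous_id)
  have ha0 : a 0 ≠ 0 := hzI
  obtain ⟨p, hp, hpO⟩ := exists_mem_shellJet_of_finite hI hc hO (x := fun _ => z.1)
    (t := fun _ => z.2.1) (a := fun s => Function.update a 1 s) (w := fun _ => w)
    continuous_const continuous_const (hupd a 1) (fun _ => continuous_const) (s₀ := a 1)
    (by simpa using ha0) (by simpa using hz) (B := {-(a 0 ^ 4)}) (by simp)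
  obtain ⟨b, hb, hbO⟩ := exists_mem_shellJet_of_finite hI hc hO (x := fun _ => z.1)
    (t := fun _ => z.2.1) (a := fun _ => Function.update a 1 p)
    (w := fun s => Function.update w 1 s)
    continuous_const continuous_const (fun _ => continuous_const) (hupd w 1) (s₀ := w 1)
    (by simpa using ha0) (by simpa using hpO)
    (B := {0, (1 + c (a 0) ^ 2 * p) / c (a 0), -((1 + c (a 0) ^ 2 * p) / c (a 0))}) (by simp)
  obtain ⟨m, hm, hmO⟩ := exists_mem_shellJet_of_finite hI hc hO (x := fun _ => z.1)
    (t := fun _ => z.2.1) (a := fun _ => Function.update a 1 p)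
    (w := fun s => Function.update (Function.update w 1 b) 2 s)
    continuous_const continuous_const (fun _ => continuous_const)
    (hupd _ 2) (s₀ := w 2)
    (by simpa using ha0) (by
      have : Function.update (Function.update w 1 b) 2 (w 2) = Function.update w 1 b := by
        rw [Function.update_eq_self_iff]; simp
      rw [this]; exact hbO)
    -- The single excluded value is the root of that affine function.
    (B := {(b * (p + a 2 / a 0 ^ 3 - 3 * p ^ 2 / a 0 ^ 4) - 3 * b ^ 3) / (a 0 + p / a 0 ^ 3)})
    (by simp)
  simp only [Set.mem_insert_iff, not_or] at hb
  rw [Set.mem_singleton_iff] at hp hm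
  have hA : a 0 + p / a 0 ^ 3 ≠ 0 := by
    intro h
    apply hp
    field_simp at h
    linarith
  refine ⟨_, hmO, shellJet_mem_shell hI hc _ _ (by simpa using ha0), ?_, ?_, ?_⟩
  · simpa [shellJet] using hb.1
  · refine determinant_ne_zero ?_
    simpa [shellJet] using hb.2
  · intro h
    apply hm
    rw [eq_div_iff hA]
    simp [w6Generic, shellJet] at h
    linarith

/-- The coefficients involve `U = t + v`, so `Zᵗ` itself depends on `v` and the step-function
argument does not apply directly. Instead two solutions whose potentials differ by a constant are
compared, to first order along `x`. -/
theorem not_yieldsLocalSymmetryOn_W₆ {O : Set (Jet (Fin 2))}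
    (hO : IsOpen O) (hOI : O ⊆ domain {u | u ≠ 0})
    (hne : (O ∩ shell (potentialSystem fun u => u ^ (-2 : ℤ))).Nonempty) :
    ¬ YieldsLocalSymmetryOn (fun u => u ^ (-2 : ℤ)) W₆ O := by
  have hI : IsOpen {u : ℝ | u ≠ 0} := isOpen_ne
  have hc := contDiffOn_zpow_neg_two
  rintro ⟨Z, ⟨-, hζ, -, -⟩, hZ, hS, q, -, hq⟩
  obtain ⟨h1, h2, h3⟩ := tracesBack_base hZ
  set c : ℝ → ℝ := fun u => u ^ (-2 : ℤ) with hcdef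
  set ζ : Jet (Fin 2) → ℝ := fun z => (Z z).2.1 with hζdef
  have hDX : ∀ z ∈ O, z ∈ shell (potentialSystem c) → determinant c z ≠ 0 →
      DX ζ z = 3 * z.2.2 0 0 1 * (z.2.1 + z.2.2 1 0 0) -
        (z.2.2 0 0 0 + z.2.2 0 1 0 / z.2.2 0 0 0 ^ 3) := by
    intro z hz hzs hΔ
    obtain ⟨⟨r1, -, -⟩, r4, -, -⟩ := shell_relations hI hc (hOI hz) hzs
    have hu : z.2.2 0 0 0 ≠ 0 := hOI hz
    have hk : c (z.2.2 0 0 0) = (z.2.2 0 0 0 ^ 2)⁻¹ := rfl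
    have d3 : HasDerivAt (fun u : ℝ => (u ^ 3)⁻¹)
        (-(3 * z.2.2 0 0 0 ^ 2) / (z.2.2 0 0 0 ^ 3) ^ 2) (z.2.2 0 0 0) := by
      simpa using (hasDerivAt_pow 3 (z.2.2 0 0 0)).fun_inv (pow_ne_zero 3 hu)
    have hξ := fun w => hasLineDerivAt_neg (hasLineDerivAt_mul (hasLineDerivAt_time_add (z := z) w)
      (hasLineDerivAt_comp d3 (hasLineDerivAt_coord 0 0 0 z w)))
    have hτ := fun w => hasLineDerivAt_mul (hasLineDerivAt_coord 0 0 0 z w)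
      (hasLineDerivAt_time_add (z := z) w)
    have hφ := fun w => hasLineDerivAt_pow (hasLineDerivAt_time_add (z := z) w) 2
    have key := DX_time_component hI hc hO hOI hζ hS
      (fun z hz => (h1 z hz).trans (by simp only [W₆]; rw [div_eq_mul_inv])) h2 h3 hz hzs
      (hξ _) (hξ _) (hτ _) (hτ _) (hφ _) (hφ _) rfl rfl rfl hk (hasDerivAt_zpow_neg_two hu).deriv
    refine mul_left_cancel₀ hΔ ?_
    simp only [determinant]
    rw [hk] at r4 ⊢
    simp only [zero_add, W₆, r1, r4] at key
    refine key.trans ?_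
    field_simp
    ring
  -- Equality of the two values of `δu` fixes how `ζ` responds to a change of `v` alone.
  have hind : ∀ z ∈ O, ∀ z' ∈ O, z ∈ shell (potentialSystem c) → z' ∈ shell (potentialSystem c) →
      forget z = forget z' → (ζ z' - ζ z) * z.2.2 0 0 1 = (z'.2.2 1 0 0 - z.2.2 1 0 0) *
        (z.2.2 0 0 0 + z.2.2 0 1 0 / z.2.2 0 0 0 ^ 3) := by
    intro z hz z' hz' hzs hzs' h
    have e := hq z' hz' hzs'
    obtain ⟨e1, e2, e3⟩ := coord_eq_of_forget_eq h
    rw [← h, ← hq z hz hzs] at e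
    simp only [characteristic, Matrix.cons_val_zero, h1 z hz, h1 z' hz', h2 z hz, h2 z' hz', W₆,
      ← e2, ← e3] at e
    simp only [hζdef]
    linear_combination -e
  set f : Jet (Fin 2) → ℝ := fun z => z.2.2 0 0 1 * determinant c z * w6Generic z with hf
  have hO' : IsOpen (O ∩ f ⁻¹' {0}ᶜ) := by
    refine ContinuousOn.isOpen_inter_preimage ?_ hO isOpen_compl_singleton
    exact (((Continuous.continuousOn (by fun_prop)).mul (continuousOn_determinant hc)).mul
      continuousOn_w6Generic).mono hOI
  obtain ⟨z, hz, hzs, hzg⟩ := exists_mem_shell_w6Generic hc hO hOI hne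
  have hzI : z.2.2 0 0 0 ∈ {u : ℝ | u ≠ 0} := hOI hz
  have hz' : z ∈ O ∩ f ⁻¹' {0}ᶜ := ⟨hz, by simp [hf, hzg.1, hzg.2.1, hzg.2.2]⟩
  rw [eq_shellJet hI hc hzI hzs] at hz'
  set t := z.2.1
  set x := z.1
  obtain ⟨A, V, hA, hV, hAx, hmem⟩ :=
    exists_shellCurve_mem hI hc hO' (a := fun i => z.2.2 0 i 0) hzI hz'
  -- With `P = 1` the parameter shifts `v` by a constant and leaves the jet of `u` unchanged at
  -- every point of the curve.
  set γ := shellCurve c t A V fun _ => 1 with hγ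
  have hshell : ∀ {s y}, γ s y ∈ O → γ s y ∈ shell (potentialSystem c) ∧ A y ≠ 0 := fun h => by
    have hAI := hOI h
    simp only [domain, hγ, shellCurve, shellJet, Set.mem_ofPred_eq, Matrix.cons_val_zero,
      uCoord_zero, iteratedDeriv_zero] at hAI
    exact ⟨shellJet_mem_shell hI hc _ _ (by simpa using hAI), hAI⟩
  have hcont := continuousAt_shellCurve hI hc hA hV (P := fun _ => 1) contDiff_const t 0 hAx
  have hev := hcont.eventually_mem (hO'.mem_nhds (hmem _))
  rw [nhds_prod_eq] at hev
  obtain ⟨ps, hps, px, hpx, hall⟩ := eventually_prod_iff.1 hev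
  -- A single nonzero shift that works for all points near `x`, so that the identity below may be
  -- differentiated in `x`.
  obtain ⟨s, hs, hs0⟩ := ((hps.filter_mono nhdsWithin_le_nhds).and
    (self_mem_nhdsWithin (s := {(0 : ℝ)}ᶜ))).exists
  have hs0 : s ≠ 0 := hs0
  have hsO : ∀ᶠ y in 𝓝 x, γ s y ∈ O ∩ f ⁻¹' {0}ᶜ := hpx.mono fun y hy => hall hs hy
  have h0O : ∀ᶠ y in 𝓝 x, γ 0 y ∈ O ∩ f ⁻¹' {0}ᶜ := hpx.mono fun y hy => hall hps.self_of_nhds hy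
  have hfg : ∀ y, forget (γ 0 y) = forget (γ s y) := fun y =>
    forget_shellCurve_eq 0 s fun i => by rw [iteratedDeriv_const]; simp
  have hu0 : ∀ s' y i, (γ s' y).2.2 0 i 0 = iteratedDeriv i A y := fun s' y i => by
    simp [hγ, shellCurve, shellJet]
  have hu1 : ∀ s' y i, (γ s' y).2.2 0 i 1 = iteratedDeriv (i + 1) V y := fun s' y i => by
    simp [hγ, shellCurve, shellJet, iteratedDeriv_const]
  have hv : ∀ s' y, (γ s' y).2.2 1 0 0 = V y + s' := fun s' y => by
    simp [hγ, shellCurve, shellJet]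
  have hne0 : (γ 0 x).2.2 0 0 1 ≠ 0 ∧ determinant c (γ 0 x) ≠ 0 ∧ w6Generic (γ 0 x) ≠ 0 := by
    have := h0O.self_of_nhds.2
    simpa [hf, and_assoc] using this
  have hnes : determinant c (γ s x) ≠ 0 := by
    have := hsO.self_of_nhds.2
    simp only [hf, Set.mem_preimage, Set.mem_compl_iff, Set.mem_singleton_iff, mul_eq_zero,
      not_or] at this
    exact this.1.2
  have hd : ∀ {s'}, γ s' x ∈ O → determinant c (γ s' x) ≠ 0 →
      HasDerivAt (fun y => ζ (γ s' y)) (3 * iteratedDeriv 1 V x * (t + (V x + s')) -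
        (A x + iteratedDeriv 1 A x / A x ^ 3)) x := fun {s'} h hΔ => by
    have := hasDerivAt_comp_shellCurve hI hc hA hV (P := fun _ => 1) contDiff_const t s' hAx hζ hO h
    rw [hDX _ h (hshell h).1 hΔ] at this
    rw [← hv s' x, ← hu1 s' x 0, ← hu0 s' x 1]
    have e : A x = (γ s' x).2.2 0 0 0 := by rw [hu0, iteratedDeriv_zero]
    rw [e]
    exact this
  have hL := ((hd hsO.self_of_nhds.1 hnes).sub (hd h0O.self_of_nhds.1 hne0.2.1)).mul
    (hasDerivAt_iteratedDeriv hV 1 x)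
  have hAd := hasDerivAt_iteratedDeriv hA 0 x
  rw [iteratedDeriv_zero] at hAd
  have hR := (hAd.add ((hasDerivAt_iteratedDeriv hA 1 x).div (hAd.pow 3)
    (pow_ne_zero 3 (hshell h0O.self_of_nhds.1).2))).const_mul s
  have heq : ∀ᶠ y in 𝓝 x, (ζ (γ s y) - ζ (γ 0 y)) * iteratedDeriv 1 V y =
      s * (A y + iteratedDeriv 1 A y / A y ^ 3) := by
    filter_upwards [hsO, h0O] with y hy hy0
    have := hind _ hy0.1 _ hy.1 (hshell hy0.1).1 (hshell hy.1).1 (hfg y)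
    rw [hv, hv, hu0, hu0, hu1, iteratedDeriv_zero] at this
    linear_combination this
  have hval := heq.self_of_nhds
  -- Both sides of `heq` are differentiated; on the left the total derivatives of `ζ` are known and
  -- differ by `3 s u_t`.
  have hder := (hL.congr_of_eventuallyEq (heq.mono fun y hy => hy.symm)).unique hR
  have hAx0 : A x ≠ 0 := hAx
  apply hne0.2.2
  apply mul_left_cancel₀ hs0
  simp only [w6Generic, hu0, hu1, iteratedDeriv_zero, zero_add, Nat.reduceAdd, mul_zero]
  have hfrac : (iteratedDeriv 2 A x * A x ^ 3 -
      iteratedDeriv 1 A x * (3 * A x ^ 2 * iteratedDeriv 1 A x)) / (A x ^ 3) ^ 2 =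
      iteratedDeriv 2 A x / A x ^ 3 - 3 * iteratedDeriv 1 A x ^ 2 / A x ^ 4 := by
    field_simp
  simp only [Pi.sub_apply, Pi.pow_apply, Nat.reduceAdd, zero_add, Nat.cast_ofNat, Nat.reduceSub,
    hfrac] at hder
  -- Eliminating the difference of the two values of `ζ` between the identity and its derivative
  -- leaves `s * w6Generic = 0`.
  linear_combination iteratedDeriv 1 V x * hder - iteratedDeriv 2 V x * hval

/-! ### Calculus of functions of `(x,t)` -/

/-- `F` is differentiable at `p` with partial derivatives `a` and `b`. -/
def HasPartials (F : ℝ × ℝ → ℝ) (a b : ℝ) (p : ℝ × ℝ) : Prop :=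
  HasFDerivAt F (a • ContinuousLinearMap.fst ℝ ℝ ℝ + b • ContinuousLinearMap.snd ℝ ℝ ℝ) p

section Partials

variable {F G : ℝ × ℝ → ℝ} {a b a' b' : ℝ} {p : ℝ × ℝ}

lemma HasPartials.px_eq (h : HasPartials F a b p) : px F p = a := by
  simp [px, HasFDerivAt.fderiv h]

lemma HasPartials.pt_eq (h : HasPartials F a b p) : pt F p = b := by
  simp [pt, HasFDerivAt.fderiv h]

lemma HasPartials.congr_partials (h : HasPartials F a b p) (ha : a = a') (hb : b = b') :
    HasPartials F a' b' p := by
  rwa [← ha, ← hb]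

lemma HasPartials.of_hasFDerivAt {L : ℝ × ℝ →L[ℝ] ℝ} (h : HasFDerivAt F L p)
    (ha : L (1, 0) = a) (hb : L (0, 1) = b) : HasPartials F a b p := by
  refine HasFDerivAt.congr_fderiv h ?_
  ext <;> simp [ha, hb]

lemma HasPartials.of_differentiableAt (h : DifferentiableAt ℝ F p) :
    HasPartials F (px F p) (pt F p) p :=
  .of_hasFDerivAt h.hasFDerivAt rfl rfl

lemma HasPartials.add (hF : HasPartials F a b p) (hG : HasPartials G a' b' p) :
    HasPartials (fun p => F p + G p) (a + a') (b + b') p :=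
  .of_hasFDerivAt (HasFDerivAt.add hF hG) (by simp) (by simp)

lemma HasPartials.sub (hF : HasPartials F a b p) (hG : HasPartials G a' b' p) :
    HasPartials (fun p => F p - G p) (a - a') (b - b') p :=
  .of_hasFDerivAt (HasFDerivAt.sub hF hG) (by simp) (by simp)

lemma HasPartials.neg (hF : HasPartials F a b p) :
    HasPartials (fun p => -F p) (-a) (-b) p :=
  .of_hasFDerivAt (HasFDerivAt.neg hF) (by simp) (by simp)

lemma HasPartials.mul (hF : HasPartials F a b p) (hG : HasPartials G a' b' p) :
    HasPartials (fun p => F p * G p) (a * G p + F p * a') (b * G p + F p * b') p :=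
  .of_hasFDerivAt (HasFDerivAt.mul hF hG) (by simp; ring) (by simp; ring)

lemma HasPartials.const_mul (r : ℝ) (hF : HasPartials F a b p) :
    HasPartials (fun p => r * F p) (r * a) (r * b) p :=
  .of_hasFDerivAt (HasFDerivAt.const_mul hF r) (by simp) (by simp)

lemma HasPartials.comp {g : ℝ → ℝ} {g' : ℝ} (hg : HasDerivAt g g' (F p))
    (hF : HasPartials F a b p) : HasPartials (fun p => g (F p)) (g' * a) (g' * b) p :=
  .of_hasFDerivAt (hg.comp_hasFDerivAt p hF) (by simp) (by simp)

lemma HasPartials.pow (hF : HasPartials F a b p) (n : ℕ) :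
    HasPartials (fun p => F p ^ n) (n * F p ^ (n - 1) * a) (n * F p ^ (n - 1) * b) p :=
  HasPartials.comp (hasDerivAt_pow n (F p)) hF

lemma hasPartials_const (r : ℝ) : HasPartials (fun _ => r) 0 0 p :=
  .of_hasFDerivAt (hasFDerivAt_const r p) rfl rfl

lemma hasPartials_fst : HasPartials (fun p => p.1) 1 0 p :=
  .of_hasFDerivAt hasFDerivAt_fst rfl rfl

lemma hasPartials_snd : HasPartials (fun p => p.2) 0 1 p :=
  .of_hasFDerivAt hasFDerivAt_snd rfl rfl

variable {Ω : Set (ℝ × ℝ)} (hΩ : IsOpen Ω)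
include hΩ

lemma hasPartials_of_contDiffOn (hF : ContDiffOn ℝ ∞ F Ω) (hp : p ∈ Ω) :
    HasPartials F (px F p) (pt F p) p :=
  .of_differentiableAt ((hF.contDiffAt (hΩ.mem_nhds hp)).differentiableAt (by simp))

lemma HasPartials.congr_of_isOpen (h : ∀ q ∈ Ω, F q = G q) (hp : p ∈ Ω)
    (hG : HasPartials G a b p) : HasPartials F a b p :=
  HasFDerivAt.congr_of_eventuallyEq hG (eventually_of_mem (hΩ.mem_nhds hp) h)

lemma contDiffOn_px (hF : ContDiffOn ℝ ∞ F Ω) : ContDiffOn ℝ ∞ (px F) Ω :=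
  (hF.fderiv_of_isOpen hΩ (by simp)).clm_apply contDiffOn_const

lemma contDiffOn_pt (hF : ContDiffOn ℝ ∞ F Ω) : ContDiffOn ℝ ∞ (pt F) Ω :=
  (hF.fderiv_of_isOpen hΩ (by simp)).clm_apply contDiffOn_const

lemma pt_px (hF : ContDiffOn ℝ ∞ F Ω) (hp : p ∈ Ω) : pt (px F) p = px (pt F) p := by
  have hd : DifferentiableAt ℝ (fderiv ℝ F) p :=
    ((hF.fderiv_of_isOpen hΩ (m := ∞) (by simp)).contDiffAt (hΩ.mem_nhds hp)).differentiableAt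
      (by simp)
  have hs : IsSymmSndFDerivAt ℝ F p :=
    (hF.contDiffAt (hΩ.mem_nhds hp)).isSymmSndFDerivAt
      (by rw [minSmoothness_of_isRCLikeNormedField]; exact WithTop.coe_le_coe.2 (le_top (a := (2 : ℕ∞))))
  have h : ∀ v w : ℝ × ℝ, fderiv ℝ (fun q => fderiv ℝ F q v) p w =
      fderiv ℝ (fderiv ℝ F) p w v := fun v w => by
    rw [fderiv_clm_apply hd (differentiableAt_const v)]
    simp
  exact (h _ _).trans ((hs _ _).trans (h _ _).symm)

/-- A closed 1-form on a convex open set has a smooth primitive. -/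
lemma exists_primitive (hconv : Convex ℝ Ω) {f g : ℝ × ℝ → ℝ} (hf : ContDiffOn ℝ ∞ f Ω)
    (hg : ContDiffOn ℝ ∞ g Ω) (h : ∀ p ∈ Ω, pt f p = px g p) :
    ∃ w : ℝ × ℝ → ℝ, ContDiffOn ℝ ∞ w Ω ∧ ∀ p ∈ Ω, HasPartials w (f p) (g p) p := by
  set α : ℝ × ℝ → ℝ × ℝ →L[ℝ] ℝ := fun p =>
    f p • ContinuousLinearMap.fst ℝ ℝ ℝ + g p • ContinuousLinearMap.snd ℝ ℝ ℝ with hα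
  have hαs : ContDiffOn ℝ ∞ α Ω := (hf.smul contDiffOn_const).add (hg.smul contDiffOn_const)
  obtain ⟨w, hw⟩ := hconv.exists_forall_hasFDerivAt_of_fderiv_symmetric hΩ
    (hαs.differentiableOn (by simp)) (fun p hp y z => by
      have e : HasFDerivAt α _ p :=
        ((hasPartials_of_contDiffOn hΩ hf hp).smul_const (ContinuousLinearMap.fst ℝ ℝ ℝ)).add
        ((hasPartials_of_contDiffOn hΩ hg hp).smul_const (ContinuousLinearMap.snd ℝ ℝ ℝ))
      rw [e.fderiv]
      simp
      rw [h p hp]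
      ring)
  refine ⟨w, ?_, hw⟩
  -- The primitive is smooth because its derivative is the given smooth form.
  rw [contDiffOn_infty_iff_fderiv_of_isOpen hΩ]
  exact ⟨fun p hp => (hw p hp).differentiableAt.differentiableWithinAt,
    hαs.congr fun p hp => (hw p hp).fderiv⟩

end Partials

/-! ### Symmetries of the wave equation -/

/-- `W` yields a symmetry as soon as, along each solution and potential, there is a function `ζ`
that satisfies the determining equations of the component `Zᵗ`. -/
theorem yieldsSymmetry_of_determining {c : ℝ → ℝ} {I : Set ℝ} (hI : IsOpen I)
    (hc : ContDiffOn ℝ ∞ c I) {W : Generator}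
    (H : ∀ (Ω : Set (ℝ × ℝ)) (u v : ℝ × ℝ → ℝ), IsOpen Ω → Convex ℝ Ω →
      ContDiffOn ℝ ∞ u Ω → (∀ p ∈ Ω, u p ∈ I) → ContDiffOn ℝ ∞ v Ω →
      (∀ p ∈ Ω, HasPartials v (pt u p) (c (u p) ^ 2 * px u p) p) →
      ∃ ξ τ φ ζ : ℝ × ℝ → ℝ, ContDiffOn ℝ ∞ ξ Ω ∧ ContDiffOn ℝ ∞ τ Ω ∧ ContDiffOn ℝ ∞ φ Ω ∧
        ContDiffOn ℝ ∞ ζ Ω ∧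
        (∀ p ∈ Ω, ξ p = W.ξ p.1 (u p) (p.2 + v p)) ∧ (∀ p ∈ Ω, τ p = W.τ p.1 (u p) (p.2 + v p)) ∧
        (∀ p ∈ Ω, φ p = W.φ p.1 (u p) (p.2 + v p)) ∧
        ∀ p ∈ Ω, ∃ ξx ξt τx τt φx φt ζx ζt, HasPartials ξ ξx ξt p ∧ HasPartials τ τx τt p ∧
          HasPartials φ φx φt p ∧ HasPartials ζ ζx ζt p ∧
          -(1 + c (u p) ^ 2 * px u p) * ζx + pt u p * ζt =
            τt - ξt * px u p - φx + ξx * pt u p ∧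
          c (u p) ^ 2 * pt u p * ζx - (1 + c (u p) ^ 2 * px u p) * ζt =
            c (u p) ^ 2 * (τx - ξx * px u p) + 2 * c (u p) * deriv c (u p) * px u p * τ p - φt +
              ξt * pt u p) :
    YieldsSymmetry c I W := by
  intro Ω u hΩ hconv ⟨hu, huI, hwave⟩
  have hux := contDiffOn_px hΩ hu
  have hut := contDiffOn_pt hΩ hu
  have hcu : ContDiffOn ℝ ∞ (fun p => c (u p)) Ω := hc.comp hu huI
  have hflux : ContDiffOn ℝ ∞ (fun p => c (u p) ^ 2 * px u p) Ω := (hcu.pow 2).mul hux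
  refine ⟨?_, ?_⟩
  · obtain ⟨v, hv, hv'⟩ := exists_primitive hΩ hconv hut hflux hwave
    exact ⟨v, hv, fun p hp => ⟨(hv' p hp).px_eq, (hv' p hp).pt_eq⟩⟩
  intro v ⟨hv, hpot⟩
  have hvp : ∀ p ∈ Ω, HasPartials v (pt u p) (c (u p) ^ 2 * px u p) p := fun p hp =>
    (hasPartials_of_contDiffOn hΩ hv hp).congr_partials (hpot p hp).1 (hpot p hp).2
  obtain ⟨ξ, τ, φ, ζ, hξ, hτ, hφ, hζ, eξ, eτ, eφ, hdet⟩ := H Ω u v hΩ hconv hu huI hv hvp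
  have hδ : ContDiffOn ℝ ∞ (fun p => τ p - ξ p * px u p - ζ p * pt u p) Ω :=
    (hτ.sub (hξ.mul hux)).sub (hζ.mul hut)
  have hε : ContDiffOn ℝ ∞ (fun p => (φ p - ζ p) - ξ p * px v p - ζ p * pt v p) Ω :=
    ((hφ.sub hζ).sub (hξ.mul (contDiffOn_px hΩ hv))).sub (hζ.mul (contDiffOn_pt hΩ hv))
  have hlin : SolvesLinPotential c Ω u (fun p => τ p - ξ p * px u p - ζ p * pt u p)
      (fun p => (φ p - ζ p) - ξ p * px v p - ζ p * pt v p) := by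
    intro p hp
    obtain ⟨ξx, ξt, τx, τt, φx, φt, ζx, ζt, dξ, dτ, dφ, dζ, E1, E2⟩ := hdet p hp
    have dux := hasPartials_of_contDiffOn hΩ hux hp
    have dut := hasPartials_of_contDiffOn hΩ hut hp
    have dflux := (HasPartials.comp (hasDerivAt_of_contDiffOn hI hc (huI p hp))
      (hasPartials_of_contDiffOn hΩ hu hp)).pow 2 |>.mul dux
    have hw := hwave p hp
    rw [dflux.px_eq] at hw
    -- The wave equation replaces `u_tt` and symmetry replaces `u_tx`; the second derivatives of `u`
    -- then cancel and only the determining equations `E1`, `E2` remain.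
    rw [hw, pt_px hΩ hu hp |>.symm] at dut
    have dδ := (dτ.sub (dξ.mul dux)).sub (dζ.mul dut)
    have dε := HasPartials.congr_of_isOpen hΩ
      (F := fun p => (φ p - ζ p) - ξ p * px v p - ζ p * pt v p)
      (G := fun p => (φ p - ζ p) - ξ p * pt u p - ζ p * (c (u p) ^ 2 * px u p))
      (fun q hq => by simp only [(hpot q hq).1, (hpot q hq).2]) hp
      (((dφ.sub dζ).sub (dξ.mul dut)).sub (dζ.mul dflux))
    refine ⟨?_, ?_⟩
    · rw [dε.px_eq, dδ.pt_eq]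
      push_cast
      linear_combination E1
    · rw [dε.pt_eq, linFlux, dδ.px_eq]
      push_cast
      linear_combination E2
  refine ⟨fun p => (ξ p, ζ p, τ p, φ p - ζ p), hξ.prodMk (hζ.prodMk (hτ.prodMk (hφ.sub hζ))),
    fun p hp => ?_, hlin, fun p hp => ?_⟩
  · rw [tracesBack_iff]
    exact ⟨eξ p hp, eτ p hp, by rw [← eφ p hp]; ring⟩
  -- Cross-differentiation: `δ_tt = (ε_x)_t = (ε_t)_x`, and `ε_t` is the linearized flux.
  · have e1 := HasPartials.congr_of_isOpen hΩ (fun q hq => ((hlin q hq).1).symm) hp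
      (hasPartials_of_contDiffOn hΩ (contDiffOn_px hΩ hε) hp)
    have e2 := HasPartials.congr_of_isOpen hΩ (fun q hq => ((hlin q hq).2).symm) hp
      (hasPartials_of_contDiffOn hΩ (contDiffOn_pt hΩ hε) hp)
    exact e1.pt_eq.trans ((pt_px hΩ hε hp).trans e2.px_eq.symm)

theorem yieldsSymmetry_W₃ {c C : ℝ → ℝ} {I : Set ℝ} (hI : IsOpen I)
    (hc : ContDiffOn ℝ ∞ c I) (hC : ∀ u ∈ I, HasDerivAt C (c u ^ 2) u) :
    YieldsSymmetry c I (W₃ C) := by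
  have hCs : ContDiffOn ℝ ∞ C I := by
    rw [contDiffOn_infty_iff_deriv_of_isOpen hI]
    exact ⟨fun u hu => (hC u hu).differentiableAt.differentiableWithinAt,
      (hc.pow 2).congr fun u hu => (hC u hu).deriv⟩
  refine yieldsSymmetry_of_determining hI hc fun Ω u v hΩ hconv hu huI hv hvp => ?_
  have hU : ContDiffOn ℝ ∞ (fun p : ℝ × ℝ => p.2 + v p) Ω := contDiff_snd.contDiffOn.add hv
  -- The choice `Zᵗ = t + v` equals `φ`, so `Zᵛ = 0`.
  refine ⟨fun p => p.1 + C (u p), fun _ => 0, fun p => p.2 + v p, fun p => p.2 + v p,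
    contDiff_fst.contDiffOn.add (hCs.comp hu huI), contDiffOn_const, hU, hU, fun _ _ => rfl,
    fun _ _ => rfl, fun _ _ => rfl, fun p hp => ?_⟩
  have dU := hasPartials_snd.add (hvp p hp)
  refine ⟨_, _, _, _, _, _, _, _, hasPartials_fst.add
    (HasPartials.comp (hC _ (huI p hp)) (hasPartials_of_contDiffOn hΩ hu hp)),
    hasPartials_const 0, dU, dU, ?_, ?_⟩ <;> ring

theorem yieldsSymmetry_W₆ : YieldsSymmetry (fun u => u ^ (-2 : ℤ)) {u | u ≠ 0} W₆ := by
  refine yieldsSymmetry_of_determining isOpen_ne contDiffOn_zpow_neg_two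
    fun Ω u v hΩ hconv hu huI hv hvp => ?_
  have hU : ContDiffOn ℝ ∞ (fun p : ℝ × ℝ => p.2 + v p) Ω := contDiff_snd.contDiffOn.add hv
  -- A second-level potential with `w_x = u`, `w_t = t + v`; closedness is `u_t = v_x`. It supplies
  -- the terms of `D_x Zᵗ` and `D_t Zᵗ` that are not derivatives of local expressions.
  obtain ⟨w, hw, hwp⟩ := exists_primitive hΩ hconv hu hU fun p hp => by
    rw [(hasPartials_snd.add (hvp p hp)).px_eq, zero_add]
  have hinv : ∀ n, ContDiffOn ℝ ∞ (fun p => (u p ^ n)⁻¹) Ω := fun n =>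
    (hu.pow n).inv fun p hp => pow_ne_zero n (huI p hp)
  refine ⟨fun p => -((p.2 + v p) * (u p ^ 3)⁻¹), fun p => u p * (p.2 + v p),
    fun p => (p.2 + v p) ^ 2, fun p => 3 / 2 * (p.2 + v p) ^ 2 + 1 / 2 * (u p ^ 2)⁻¹ - w p,
    (hU.mul (hinv 3)).neg, hu.mul hU, hU.pow 2,
    ((contDiffOn_const.mul (hU.pow 2)).add (contDiffOn_const.mul (hinv 2))).sub hw,
    fun _ _ => by simp only [W₆, div_eq_mul_inv], fun _ _ => rfl, fun _ _ => rfl, fun p hp => ?_⟩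
  have hu0 : u p ≠ 0 := huI p hp
  have dU := hasPartials_snd.add (hvp p hp)
  have du := hasPartials_of_contDiffOn hΩ hu hp
  have d3 := (hasDerivAt_pow 3 (u p)).fun_inv (pow_ne_zero 3 hu0)
  have d2 := (hasDerivAt_pow 2 (u p)).fun_inv (pow_ne_zero 2 hu0)
  have hk : u p ^ (-2 : ℤ) = (u p ^ 2)⁻¹ := rfl
  refine ⟨_, _, _, _, _, _, _, _, (dU.mul (HasPartials.comp d3 du)).neg, du.mul dU, dU.pow 2,
    (((dU.pow 2).const_mul _).add ((HasPartials.comp d2 du).const_mul _)).sub (hwp p hp), ?_, ?_⟩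
  · simp only [hk]
    push_cast
    field_simp
    ring
  · simp only [hk, (hasDerivAt_zpow_neg_two hu0).deriv]
    push_cast
    field_simp
    ring

theorem yieldsSymmetry_W₇ :
    YieldsSymmetry (fun u => u ^ (-(2 / 3) : ℝ)) {u | 0 < u} W₇ := by
  refine yieldsSymmetry_of_determining (isOpen_lt continuous_const continuous_id)
    (contDiffOn_rpow_pos _) fun Ω u v hΩ hconv hu huI hv hvp => ?_
  have hr : ∀ e : ℝ, ContDiffOn ℝ ∞ (fun p => u p ^ e) Ω := fun e =>
    (contDiffOn_rpow_pos e).comp hu huI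
  have hx : ContDiffOn ℝ ∞ (fun p : ℝ × ℝ => p.1) Ω := contDiff_fst.contDiffOn
  -- Integrating `ζ_x = -(x/3) v_x` by parts leaves a potential with `y_x = v/3`. Its `t`-derivative
  -- is `-u^(-1/3)`, since `c² = u^(-4/3)`.
  obtain ⟨y, hy, hyp⟩ := exists_primitive hΩ hconv (f := fun p => 1 / 3 * v p)
    (g := fun p => -u p ^ (-(1 / 3) : ℝ)) (contDiffOn_const.mul hv) (hr _).neg fun p hp => by
      obtain ⟨s, hs0, hs, e1, e2, e3, d1, d2, d3, -⟩ := exists_cube_root (u := u p) (huI p hp)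
      rw [((hvp p hp).const_mul _).pt_eq,
        (HasPartials.comp d1 (hasPartials_of_contDiffOn hΩ hu hp)).neg.px_eq, e3]
      field_simp
  refine ⟨fun p => p.1 * u p ^ (-(1 / 3) : ℝ) - 1 / 3 * p.1 ^ 2,
    fun p => p.1 * u p - 3 * u p ^ (2 / 3 : ℝ), fun _ => 0,
    fun p => -(1 / 3 * (p.1 * v p)) + y p,
    (hx.mul (hr _)).sub (contDiffOn_const.mul (hx.pow 2)),
    (hx.mul hu).sub (contDiffOn_const.mul (hr _)), contDiffOn_const,
    (contDiffOn_const.mul (hx.mul hv)).neg.add hy, fun _ _ => by simp only [W₇]; ring,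
    fun _ _ => rfl, fun _ _ => rfl, fun p hp => ?_⟩
  obtain ⟨s, hs0, hs, e1, e2, e3, d1, d2, d3, -⟩ := exists_cube_root (u := u p) (huI p hp)
  have du := hasPartials_of_contDiffOn hΩ hu hp
  refine ⟨_, _, _, _, _, _, _, _,
    (hasPartials_fst.mul (HasPartials.comp d1 du)).sub ((hasPartials_fst.pow 2).const_mul _),
    (hasPartials_fst.mul du).sub ((HasPartials.comp d2 du).const_mul _), hasPartials_const 0,
    ((hasPartials_fst.mul (hvp p hp)).const_mul _).neg.add (hyp p hp), ?_, ?_⟩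
  · simp only [e1, e3]
    push_cast
    field_simp
    ring
  · simp only [e1, e2, e3, d3.deriv]
    rw [hs]
    push_cast
    field_simp
    ring

/-! ### Point symmetries of the equation for `U(X,T)` -/

/-- `F` has the total derivatives `Fx`, `Ft` on `D`, and these have the total derivatives `Fxx`,
`Fxt`, `Ftt` at `z`. -/
def HasTotalDerivs (D : Set (Jet (Fin 1))) (z : Jet (Fin 1)) (F Fx Ft : Jet (Fin 1) → ℝ)
    (Fxx Fxt Ftt : ℝ) : Prop :=
  (∀ y ∈ D, HasLineDerivAt ℝ F (Fx y) y (1, 0, fun a i j => y.2.2 a (i + 1) j) ∧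
    HasLineDerivAt ℝ F (Ft y) y (0, 1, fun a i j => y.2.2 a i (j + 1))) ∧
  HasLineDerivAt ℝ Fx Fxx z (1, 0, fun a i j => z.2.2 a (i + 1) j) ∧
  HasLineDerivAt ℝ Ft Fxt z (1, 0, fun a i j => z.2.2 a (i + 1) j) ∧
  HasLineDerivAt ℝ Ft Ftt z (0, 1, fun a i j => z.2.2 a i (j + 1))

section TotalDerivs

variable {D : Set (Jet (Fin 1))} {z : Jet (Fin 1)} {F Fx Ft G Gx Gt : Jet (Fin 1) → ℝ}
  {Fxx Fxt Ftt Gxx Gxt Gtt : ℝ}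

lemma HasTotalDerivs.sub (hF : HasTotalDerivs D z F Fx Ft Fxx Fxt Ftt)
    (hG : HasTotalDerivs D z G Gx Gt Gxx Gxt Gtt) :
    HasTotalDerivs D z (fun z => F z - G z) (fun z => Fx z - Gx z) (fun z => Ft z - Gt z)
      (Fxx - Gxx) (Fxt - Gxt) (Ftt - Gtt) :=
  ⟨fun y hy => ⟨hasLineDerivAt_sub (hF.1 y hy).1 (hG.1 y hy).1,
    hasLineDerivAt_sub (hF.1 y hy).2 (hG.1 y hy).2⟩, hasLineDerivAt_sub hF.2.1 hG.2.1,
    hasLineDerivAt_sub hF.2.2.1 hG.2.2.1, hasLineDerivAt_sub hF.2.2.2 hG.2.2.2⟩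

lemma HasTotalDerivs.add (hF : HasTotalDerivs D z F Fx Ft Fxx Fxt Ftt)
    (hG : HasTotalDerivs D z G Gx Gt Gxx Gxt Gtt) :
    HasTotalDerivs D z (fun z => F z + G z) (fun z => Fx z + Gx z) (fun z => Ft z + Gt z)
      (Fxx + Gxx) (Fxt + Gxt) (Ftt + Gtt) :=
  ⟨fun y hy => ⟨hasLineDerivAt_add (hF.1 y hy).1 (hG.1 y hy).1,
    hasLineDerivAt_add (hF.1 y hy).2 (hG.1 y hy).2⟩, hasLineDerivAt_add hF.2.1 hG.2.1,
    hasLineDerivAt_add hF.2.2.1 hG.2.2.1, hasLineDerivAt_add hF.2.2.2 hG.2.2.2⟩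

lemma HasTotalDerivs.const_mul (r : ℝ) (hF : HasTotalDerivs D z F Fx Ft Fxx Fxt Ftt) :
    HasTotalDerivs D z (fun z => r * F z) (fun z => r * Fx z) (fun z => r * Ft z)
      (r * Fxx) (r * Fxt) (r * Ftt) :=
  ⟨fun y hy => ⟨hasLineDerivAt_constMul r (hF.1 y hy).1, hasLineDerivAt_constMul r (hF.1 y hy).2⟩,
    hasLineDerivAt_constMul r hF.2.1, hasLineDerivAt_constMul r hF.2.2.1,
    hasLineDerivAt_constMul r hF.2.2.2⟩

lemma HasTotalDerivs.mul (hz : z ∈ D) (hF : HasTotalDerivs D z F Fx Ft Fxx Fxt Ftt)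
    (hG : HasTotalDerivs D z G Gx Gt Gxx Gxt Gtt) :
    HasTotalDerivs D z (fun z => F z * G z) (fun z => Fx z * G z + F z * Gx z)
      (fun z => Ft z * G z + F z * Gt z) (Fxx * G z + 2 * Fx z * Gx z + F z * Gxx)
      (Fxt * G z + Ft z * Gx z + Fx z * Gt z + F z * Gxt)
      (Ftt * G z + 2 * Ft z * Gt z + F z * Gtt) := by
  refine ⟨fun y hy => ⟨hasLineDerivAt_mul (hF.1 y hy).1 (hG.1 y hy).1,
    hasLineDerivAt_mul (hF.1 y hy).2 (hG.1 y hy).2⟩, ?_, ?_, ?_⟩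
  · exact HasDerivAt.congr_deriv (hasLineDerivAt_add (hasLineDerivAt_mul hF.2.1 (hG.1 z hz).1)
      (hasLineDerivAt_mul (hF.1 z hz).1 hG.2.1)) (by ring)
  · exact HasDerivAt.congr_deriv (hasLineDerivAt_add (hasLineDerivAt_mul hF.2.2.1 (hG.1 z hz).1)
      (hasLineDerivAt_mul (hF.1 z hz).1 hG.2.2.1)) (by ring)
  · exact HasDerivAt.congr_deriv (hasLineDerivAt_add (hasLineDerivAt_mul hF.2.2.2 (hG.1 z hz).2)
      (hasLineDerivAt_mul (hF.1 z hz).2 hG.2.2.2)) (by ring)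

lemma hasTotalDerivs_coord (i j : ℕ) : HasTotalDerivs D z (fun z => z.2.2 0 i j)
    (fun z => z.2.2 0 (i + 1) j) (fun z => z.2.2 0 i (j + 1)) (z.2.2 0 (i + 1 + 1) j)
    (z.2.2 0 (i + 1) (j + 1)) (z.2.2 0 i (j + 1 + 1)) :=
  ⟨fun y _ => ⟨hasLineDerivAt_coord 0 i j y _, hasLineDerivAt_coord 0 i j y _⟩,
    hasLineDerivAt_coord 0 _ _ z _, hasLineDerivAt_coord 0 _ _ z _, hasLineDerivAt_coord 0 _ _ z _⟩

lemma hasTotalDerivs_fst : HasTotalDerivs D z (fun z => z.1) (fun _ => 1) (fun _ => 0) 0 0 0 :=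
  ⟨fun y _ => ⟨hasLineDerivAt_fst y _, hasLineDerivAt_fst y _⟩, hasLineDerivAt_const _,
    hasLineDerivAt_const _, hasLineDerivAt_const _⟩

lemma hasTotalDerivs_const (r : ℝ) :
    HasTotalDerivs D z (fun _ => r) (fun _ => 0) (fun _ => 0) 0 0 0 :=
  ⟨fun _ _ => ⟨hasLineDerivAt_const _, hasLineDerivAt_const _⟩, hasLineDerivAt_const _,
    hasLineDerivAt_const _, hasLineDerivAt_const _⟩

lemma hasTotalDerivs_comp_snd {I : Set ℝ} {g g₁ : ℝ → ℝ} {g₂ : ℝ}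
    (hg : ∀ T ∈ I, HasDerivAt g (g₁ T) T) (hg₁ : HasDerivAt g₁ g₂ z.2.1) :
    HasTotalDerivs {z | z.2.1 ∈ I} z (fun z => g z.2.1) (fun _ => 0) (fun z => g₁ z.2.1) 0 0 g₂ := by
  refine ⟨fun y hy => ⟨?_, ?_⟩, hasLineDerivAt_const _, ?_, ?_⟩
  · exact HasDerivAt.congr_deriv (hasLineDerivAt_comp (hg _ hy) (hasLineDerivAt_snd y _)) (by simp)
  · exact HasDerivAt.congr_deriv (hasLineDerivAt_comp (hg _ hy) (hasLineDerivAt_snd y _)) (by simp)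
  · exact HasDerivAt.congr_deriv (hasLineDerivAt_comp hg₁ (hasLineDerivAt_snd z _)) (by simp)
  · exact HasDerivAt.congr_deriv (hasLineDerivAt_comp hg₁ (hasLineDerivAt_snd z _)) (by simp)

end TotalDerivs

/-- The derivative of the left-hand side of the equation for `U(X,T)` at a jet with first and second
order derivatives `u10`, `u01`, `u20`, `u11`, `u02`, in a direction with components `θ` (along `T`)
and `w10`, …, `w02`; here `k`, `k₁`, `k₂` are `c` and its derivatives. -/
def subsystemDeriv (k k₁ k₂ u10 u01 u20 u11 u02 θ w10 w01 w20 w11 w02 : ℝ) : ℝ :=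
  w02 + 2 * k * k₁ * θ * (k ^ 2 * u20 - u20 * u01 ^ 2 - u02 * u10 ^ 2 - 2 * u11 +
      2 * u11 * u01 * u10) +
    k ^ 2 * (2 * k * k₁ * θ * u20 + k ^ 2 * w20 - w20 * u01 ^ 2 - 2 * u20 * u01 * w01 -
      w02 * u10 ^ 2 - 2 * u02 * u10 * w10 - 2 * w11 + 2 * w11 * u01 * u10 + 2 * u11 * w01 * u10 +
      2 * u11 * u01 * w10) -
    2 * (k₁ ^ 2 + k * k₂) * θ * (u10 - u10 ^ 2 * u01) -
    2 * k * k₁ * (w10 - 2 * u10 * w10 * u01 - u10 ^ 2 * w01)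

/-- The left-hand side of the equation for `U(X,T)` as a function of the second order jet. -/
def subsystemValue (k k₁ u10 u01 u20 u11 u02 : ℝ) : ℝ :=
  u02 + k ^ 2 * (k ^ 2 * u20 - u20 * u01 ^ 2 - u02 * u10 ^ 2 - 2 * u11 + 2 * u11 * u01 * u10) -
    2 * k * k₁ * (u10 - u10 ^ 2 * u01)

/-! ### The invariance criterion with multipliers -/

section Subsystem

variable {c : ℝ → ℝ} {I : Set ℝ} (hI : IsOpen I) (hc : ContDiffOn ℝ ∞ c I)
include hI hc

lemma hasLineDerivAt_subsystem {z : Jet (Fin 1)} (hz : z.2.1 ∈ I) (w : Jet (Fin 1)) :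
    HasLineDerivAt ℝ (subsystem c 0)
      (subsystemDeriv (c z.2.1) (deriv c z.2.1) (deriv (deriv c) z.2.1) (z.2.2 0 1 0) (z.2.2 0 0 1)
        (z.2.2 0 2 0) (z.2.2 0 1 1) (z.2.2 0 0 2) w.2.1 (w.2.2 0 1 0) (w.2.2 0 0 1)
        (w.2.2 0 2 0) (w.2.2 0 1 1) (w.2.2 0 0 2)) z w := by
  have hU := fun i j => hasLineDerivAt_coord (0 : Fin 1) i j z w
  have hk := hasLineDerivAt_comp (hasDerivAt_of_contDiffOn hI hc hz) (hasLineDerivAt_snd z w)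
  have hk₁ := hasLineDerivAt_comp (hasDerivAt_deriv_of_contDiffOn hI hc hz)
    (hasLineDerivAt_snd z w)
  have hk2 := hasLineDerivAt_pow hk 2
  have hbr := hasLineDerivAt_add (hasLineDerivAt_sub (hasLineDerivAt_sub (hasLineDerivAt_sub
    (hasLineDerivAt_mul hk2 (hU 2 0)) (hasLineDerivAt_mul (hU 2 0) (hasLineDerivAt_pow (hU 0 1) 2)))
    (hasLineDerivAt_mul (hU 0 2) (hasLineDerivAt_pow (hU 1 0) 2)))
    (hasLineDerivAt_constMul 2 (hU 1 1)))
    (hasLineDerivAt_mul (hasLineDerivAt_mul (hasLineDerivAt_constMul 2 (hU 1 1)) (hU 0 1)) (hU 1 0))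
  have h := hasLineDerivAt_sub (hasLineDerivAt_add (hU 0 2) (hasLineDerivAt_mul hk2 hbr))
    (hasLineDerivAt_mul (hasLineDerivAt_mul (hasLineDerivAt_constMul 2 hk) hk₁)
      (hasLineDerivAt_sub (hU 1 0) (hasLineDerivAt_mul (hasLineDerivAt_pow (hU 1 0) 2) (hU 0 1))))
  refine HasDerivAt.congr_deriv h ?_
  simp only [subsystemDeriv]
  push_cast
  ring

/-- The infinitesimal criterion of invariance of the equation for `U(X,T)` in terms of the total
derivatives of the characteristic. -/
lemma isPointSymmetry_of_totalDerivs {W : Generator}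
    (h : ∀ z : Jet (Fin 1), z.2.1 ∈ I → ∃ Qx Qt Qxx Qxt Qtt,
      HasTotalDerivs {z | z.2.1 ∈ I} z (W.characteristic 0) Qx Qt Qxx Qxt Qtt ∧
      ∀ k k₁ k₂ u10 u01 u20 u11 u02 u30 u21 u12 u03, c z.2.1 = k → deriv c z.2.1 = k₁ →
        deriv (deriv c) z.2.1 = k₂ → z.2.2 0 1 0 = u10 → z.2.2 0 0 1 = u01 →
        z.2.2 0 2 0 = u20 → z.2.2 0 1 1 = u11 → z.2.2 0 0 2 = u02 → z.2.2 0 3 0 = u30 →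
        z.2.2 0 2 1 = u21 → z.2.2 0 1 2 = u12 → z.2.2 0 0 3 = u03 →
        -- The evolutionary form of `W` differs from its usual prolongation by `ξ D_X + τ D_T`.
        -- Hence in the applications `m = -ξ`, `n = -τ`, and `l` is the multiplier by which the
        -- prolonged `W` acts on the left-hand side. The component along `T` is `0` for the
        -- characteristic and for `D_X`, and `1` for `D_T`.
        ∃ l m n, subsystemDeriv k k₁ k₂ u10 u01 u20 u11 u02 0 (Qx z) (Qt z) Qxx Qxt Qtt =
          l * subsystemValue k k₁ u10 u01 u20 u11 u02 +
          m * subsystemDeriv k k₁ k₂ u10 u01 u20 u11 u02 0 u20 u11 u30 u21 u12 +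
          n * subsystemDeriv k k₁ k₂ u10 u01 u20 u11 u02 1 u11 u02 u21 u12 u03) :
    IsPointSymmetry c I W := by
  intro z hz hzs k
  obtain rfl : k = 0 := Subsingleton.elim _ _
  obtain ⟨Qx, Qt, Qxx, Qxt, Qtt, ⟨hQ, hxx, hxt, htt⟩, hlin⟩ := h z hz
  have hD : IsOpen {z : Jet (Fin 1) | z.2.1 ∈ I} := hI.preimage (by fun_prop)
  obtain ⟨l, m, n, hlin⟩ := hlin _ _ _ _ _ _ _ _ _ _ _ _ rfl rfl rfl rfl rfl rfl rfl rfl rfl rfl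
    rfl rfl
  have e0 : subsystemValue _ _ _ _ _ _ _ = 0 := hzs 0 0 0
  have e1 : subsystemDeriv _ _ _ _ _ _ _ _ _ _ _ _ _ _ = 0 :=
    (hasLineDerivAt_subsystem hI hc hz _).lineDeriv.symm.trans (hzs 0 1 0)
  have e2 : subsystemDeriv _ _ _ _ _ _ _ _ _ _ _ _ _ _ = 0 :=
    (hasLineDerivAt_subsystem hI hc hz _).lineDeriv.symm.trans (hzs 0 0 1)
  have q10 : (prolong W.characteristic z).2.2 0 1 0 = Qx z := (hQ z hz).1.lineDeriv
  have q01 : (prolong W.characteristic z).2.2 0 0 1 = Qt z := (hQ z hz).2.lineDeriv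
  have q20 : (prolong W.characteristic z).2.2 0 2 0 = Qxx :=
    (lineDeriv_congr_of_isOpen hD (fun y hy => (hQ y hy).1.lineDeriv) hz _).trans hxx.lineDeriv
  have q11 : (prolong W.characteristic z).2.2 0 1 1 = Qxt :=
    (lineDeriv_congr_of_isOpen hD (fun y hy => (hQ y hy).2.lineDeriv) hz _).trans hxt.lineDeriv
  have q02 : (prolong W.characteristic z).2.2 0 0 2 = Qtt :=
    (lineDeriv_congr_of_isOpen hD (fun y hy => (hQ y hy).2.lineDeriv) hz _).trans htt.lineDeriv
  refine (hasLineDerivAt_subsystem hI hc hz _).lineDeriv.trans ?_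
  rw [q10, q01, q20, q11, q02]
  refine hlin.trans ?_
  simp only [zero_add, Nat.reduceAdd] at e1 e2
  rw [e0, e1, e2]
  ring

end Subsystem

theorem isPointSymmetry_W₃ {c C : ℝ → ℝ} {I : Set ℝ} (hI : IsOpen I)
    (hc : ContDiffOn ℝ ∞ c I) (hC : ∀ u ∈ I, HasDerivAt C (c u ^ 2) u) :
    IsPointSymmetry c I (W₃ C) := by
  refine isPointSymmetry_of_totalDerivs hI hc fun z hz => ⟨_, _, _, _, _,
    ((hasTotalDerivs_coord 0 0).sub (HasTotalDerivs.mul hz (hasTotalDerivs_fst.add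
      (hasTotalDerivs_comp_snd hC ((hasDerivAt_of_contDiffOn hI hc hz).pow 2)))
      (hasTotalDerivs_coord 1 0))).sub
      (HasTotalDerivs.mul hz (hasTotalDerivs_const 0) (hasTotalDerivs_coord 0 1)), ?_⟩
  intro k k₁ k₂ u10 u01 u20 u11 u02 u30 u21 u12 u03 h1 h2 h3 h4 h5 h6 h7 h8 h9 h10 h11 h12
  refine ⟨1, -(z.1 + C z.2.1), 0, ?_⟩
  simp only [W₃, zero_add, Nat.reduceAdd, h1, h2, h4, h5, h6, h7, h8, h9, h10, h11, h12,
    subsystemDeriv, subsystemValue]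
  push_cast
  ring

theorem isPointSymmetry_W₆ : IsPointSymmetry (fun u => u ^ (-2 : ℤ)) {u | u ≠ 0} W₆ := by
  refine isPointSymmetry_of_totalDerivs isOpen_ne contDiffOn_zpow_neg_two fun z hz => ?_
  have hT : z.2.1 ≠ 0 := hz
  have hU := fun i j => hasTotalDerivs_coord (D := {z | z.2.1 ∈ {u | u ≠ 0}}) (z := z) i j
  have d3 : ∀ T ∈ {u : ℝ | u ≠ 0}, HasDerivAt (fun T : ℝ => -(T ^ 3)⁻¹) (3 * (T ^ 4)⁻¹) T := by
    intro T hT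
    have hT : T ≠ 0 := hT
    refine ((hasDerivAt_pow 3 T).fun_inv (pow_ne_zero 3 hT)).neg.congr_deriv ?_
    push_cast
    field_simp
  have d4 : HasDerivAt (fun T : ℝ => 3 * (T ^ 4)⁻¹) (-12 * (z.2.1 ^ 5)⁻¹) z.2.1 := by
    refine (((hasDerivAt_pow 4 z.2.1).fun_inv (pow_ne_zero 4 hT)).const_mul 3).congr_deriv ?_
    push_cast
    field_simp
    ring
  have hQ := ((HasTotalDerivs.mul hz (hU 0 0) (hU 0 0)).sub
    (HasTotalDerivs.mul hz (HasTotalDerivs.mul hz (hasTotalDerivs_comp_snd d3 d4) (hU 0 0))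
      (hU 1 0))).sub (HasTotalDerivs.mul hz (HasTotalDerivs.mul hz
        (hasTotalDerivs_comp_snd (fun T _ => hasDerivAt_id T) (hasDerivAt_const _ 1)) (hU 0 0))
      (hU 0 1))
  -- The characteristic is rewritten in the shape produced by the product rules.
  have hchar : W₆.characteristic 0 = fun z => z.2.2 0 0 0 * z.2.2 0 0 0 -
      -(z.2.1 ^ 3)⁻¹ * z.2.2 0 0 0 * z.2.2 0 1 0 - id z.2.1 * z.2.2 0 0 0 * z.2.2 0 0 1 := by
    funext z
    simp only [Generator.characteristic, W₆, id_eq]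
    ring
  rw [← hchar] at hQ
  refine ⟨_, _, _, _, _, hQ, ?_⟩
  intro k k₁ k₂ u10 u01 u20 u11 u02 u30 u21 u12 u03 h1 h2 h3 h4 h5 h6 h7 h8 h9 h10 h11 h12
  rw [(hasDerivAt_zpow_neg_two hT).deriv] at h2
  rw [deriv_deriv_zpow_neg_two hT] at h3
  have hk : k = (z.2.1 ^ 2)⁻¹ := h1.symm
  refine ⟨-3 * z.2.1 * u01 + 3 * u10 / z.2.1 ^ 3, z.2.2 0 0 0 / z.2.1 ^ 3,
    -(z.2.1 * z.2.2 0 0 0), ?_⟩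
  simp only [zero_add, Nat.reduceAdd, h4, h5, h6, h7, h8, h9, h10, h11, h12, id_eq]
  rw [hk, ← h2, ← h3]
  simp only [subsystemDeriv, subsystemValue]
  field_simp
  ring

theorem isPointSymmetry_W₇ :
    IsPointSymmetry (fun u => u ^ (-(2 / 3) : ℝ)) {u | 0 < u} W₇ := by
  refine isPointSymmetry_of_totalDerivs (isOpen_lt continuous_const continuous_id)
    (contDiffOn_rpow_pos _) fun z hz => ?_
  have hT : 0 < z.2.1 := hz
  have hpow : ∀ e : ℝ, ∀ T ∈ {u : ℝ | 0 < u}, HasDerivAt (fun T : ℝ => T ^ e) (e * T ^ (e - 1)) T :=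
    fun e T hT => Real.hasDerivAt_rpow_const (Or.inl (ne_of_gt hT))
  have hU := fun i j => hasTotalDerivs_coord (D := {z | z.2.1 ∈ {u | 0 < u}}) (z := z) i j
  have hX := hasTotalDerivs_fst (D := {z | z.2.1 ∈ {u | 0 < u}}) (z := z)
  have hP := fun e : ℝ => hasTotalDerivs_comp_snd (z := z) (hpow e) ((hpow (e - 1) _ hz).const_mul e)
  have hQ := ((hasTotalDerivs_const 0).sub (HasTotalDerivs.mul hz
    ((HasTotalDerivs.mul hz hX (hP (-(1 / 3)))).sub
      ((HasTotalDerivs.mul hz hX hX).const_mul (1 / 3))) (hU 1 0))).sub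
    (HasTotalDerivs.mul hz ((HasTotalDerivs.mul hz hX
      (hasTotalDerivs_comp_snd (fun T _ => hasDerivAt_id T) (hasDerivAt_const _ 1))).sub
      ((hP (2 / 3)).const_mul 3)) (hU 0 1))
  have hchar : W₇.characteristic 0 = fun z => 0 - (z.1 * z.2.1 ^ (-(1 / 3) : ℝ) -
      1 / 3 * (z.1 * z.1)) * z.2.2 0 1 0 -
      (z.1 * id z.2.1 - 3 * z.2.1 ^ (2 / 3 : ℝ)) * z.2.2 0 0 1 := by
    funext z
    simp only [Generator.characteristic, W₇, id_eq]
    ring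
  rw [← hchar] at hQ
  refine ⟨_, _, _, _, _, hQ, ?_⟩
  intro k k₁ k₂ u10 u01 u20 u11 u02 u30 u21 u12 u03 h1 h2 h3 h4 h5 h6 h7 h8 h9 h10 h11 h12
  obtain ⟨s, hs0, hs, e1, e2, e3, d1, d2, d3, d4⟩ := exists_cube_root (u := z.2.1) hz
  have f1 : -(1 / 3) * z.2.1 ^ (-(1 / 3) - 1 : ℝ) = -(1 / 3) * (s ^ 4)⁻¹ :=
    (hpow _ _ hz).unique d1
  have f2 : 2 / 3 * z.2.1 ^ (2 / 3 - 1 : ℝ) = 2 / 3 * s⁻¹ := (hpow _ _ hz).unique d2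
  have f3 : z.2.1 ^ (-(1 / 3) - 1 - 1 : ℝ) = (s ^ 7)⁻¹ := by
    rw [sub_sub, Real.rpow_sub hT, e1, show ((1 : ℝ) + 1) = (2 : ℕ) by norm_num,
      Real.rpow_natCast, hs]
    field_simp
  have f4 : z.2.1 ^ (2 / 3 - 1 - 1 : ℝ) = (s ^ 4)⁻¹ := by
    rw [sub_sub, Real.rpow_sub hT, e2, show ((1 : ℝ) + 1) = (2 : ℕ) by norm_num,
      Real.rpow_natCast, hs]
    field_simp
  rw [d3.deriv] at h2
  rw [d4] at h3
  rw [e3] at h1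
  refine ⟨-2 * z.1 + 6 * s⁻¹, -(z.1 * s⁻¹ - z.1 ^ 2 / 3), -(z.1 * s ^ 3 - 3 * s ^ 2), ?_⟩
  simp only [zero_add, Nat.reduceAdd, h4, h5, h6, h7, h8, h9, h10, h11, h12, id_eq, e1, e2, f1, f2,
    f3, f4]
  rw [← h1, ← h2, ← h3, hs]
  simp only [subsystemDeriv, subsystemValue]
  field_simp
  ring

end

end NonlinearWave

theorem mainTheorem5 :
    (∀ (I : Set ℝ) (c C : ℝ → ℝ), IsOpen I → ContDiffOn ℝ ∞ c I →
      (∀ u ∈ I, HasDerivAt C (c u ^ 2) u) →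
      NonlinearWave.YieldsNonlocalSymmetry c I (NonlinearWave.W₃ C)) ∧
    NonlinearWave.YieldsNonlocalSymmetry (fun u => u ^ (-2 : ℤ)) {u | u ≠ 0} NonlinearWave.W₆ ∧
    NonlinearWave.YieldsNonlocalSymmetry (fun u => u ^ (-(2 / 3) : ℝ)) {u | 0 < u}
      NonlinearWave.W₇ := by
  open NonlinearWave in
  exact ⟨fun I c C hI hc hC => ⟨isPointSymmetry_W₃ hI hc hC, yieldsSymmetry_W₃ hI hc hC,
      fun O hO hOI hne => not_yieldsLocalSymmetryOn_W₃ hI hc hC hO hOI hne⟩,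
    ⟨isPointSymmetry_W₆, yieldsSymmetry_W₆,
      fun O hO hOI hne => not_yieldsLocalSymmetryOn_W₆ hO hOI hne⟩,
    isPointSymmetry_W₇, yieldsSymmetry_W₇,
      fun O hO hOI hne => not_yieldsLocalSymmetryOn_W₇ hO hOI hne⟩
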